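/- **Setting.** Let $\Sigma$ be a ranked alphabet, and let $T_\Sigma(Z)$ be the set of $\Sigma$-trees indexed by a set $Z$, $T_\Sigma=T_\Sigma(\emptyset)$. Positions of trees are words over the natural numbers, and $\preceq$ is the lexicographic order on positions in which prefixes are larger. A *weighted tree grammar with equality constraints* (WTGc) over $\mathbb N$ is a tuple $(Q,\Sigma,F,P,\mathrm{wt})$ with a finite set $Q$ of states, $F\colon Q\to\mathbb N$, a finite set $P$ of productions $\ell\xrightarrow{E}q$ with $\ell\in T_\Sigma(Q)\setminus Q$, $q\in Q$ and $E$ a finite set of pairs of positions, and $\mathrm{wt}\colon P\to\mathbb N$. For $t\in T_\Sigma$, a production $p=(\ell\xrightarrow{E}q)$ can be applied at position $w$ of a sentential form $\xi\in T_\Sigma(Q)$ if $\xi|_w=\ell$ and, for all $(v,v')\in E$, $v$ and $v'$ are positions of $t|_w$ with $(t|_w)|_v=(t|_w)|_{v'}$; the result is $\xi[q]_w$. $D^q_G(t)$ is the set of derivations $d=(p_1,w_1)\cdots(p_n,w_n)$ that lead from $t$ to $q$ and are left-most, i.e. $w_1\prec\dots\prec w_n$. With $\mathrm{wt}_G(d)=\prod_i\mathrm{wt}(p_i)$,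 the weighted tree language generated by $G$ is $[\![G]\!](t)=\sum_{q\in Q}\sum_{d\in D^q_G(t)}F(q)\,\mathrm{wt}_G(d)$. A *weighted tree automaton* is a WTGc in which every production has $E=\emptyset$ and a left-hand side whose only position labeled by a symbol of $\Sigma$ is the root. A function $T_\Sigma\to\mathbb N$ is *regular* if it is generated by a weighted tree automaton. A *WTGh* is a WTGc $G=(Q\cup\{\bot\},\Sigma,F,P,\mathrm{wt})$, $\bot\notin Q$, such that $F(\bot)=0$; for every $\gamma\in\Sigma$ the production $p_\gamma=\gamma(\bot,\dots,\bot)\to\bot$ (without constraints) is in $P$ and has weight $1$; $\bot$ is a sink, i.e. every production with target $\bot$ has no state other than $\bot$ in its left-hand side; and for every production $\ell\xrightarrow{E}q$ the set $E$ is an equivalence relation on a set of state-labeled positions of $\ell$ such that in each class the $\preceq$-least position carries a state other than $\bot$ and all other positions carry $\bot$. It is *trim* if every production of $P$ other than the $p_\gamma$ occurs in some $d\in D^q_G(t)$, for some $q$ and $t$, with $F(q)\cdot\mathrm{wt}_G(d)\neq0$. Its *height* is $\mathrm{ht}(G)=|Q|\cdot\max_{(\ell\to q)\in P}\mathrm{ht}(\ell)$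 (the sink $\bot$ is not counted). $G$ has the *large duplication property* if there are a production $\ell\xrightarrow{E}q$ in $P$, a constraint $(u,v)\in E$ with $\ell(u)\neq\bot=\ell(v)$, and a tree $t\in T_\Sigma$ with $\mathrm{ht}(t)>\mathrm{ht}(G)$ and $D_G^{\ell(u)}(t)\neq\emptyset$. **Theorem.** If a trim WTGh $G$ has the large duplication property, then $[\![G]\!]$ is not regular. -/

import Mathlib

namespace HomTree

/-- The set `T_Σ(Z)` of trees over the ranked alphabet `(A, rk)` indexed by `Z`. -/
inductive RTree {A : Type*} (rk : A → ℕ) (Z : Type*) where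
  | var (z : Z) : RTree rk Z
  | node (a : A) (ts : Fin (rk a) → RTree rk Z) : RTree rk Z

/-- The set `T_Σ` of trees without indices. -/
abbrev GTree {A : Type*} (rk : A → ℕ) := RTree rk Empty

/-- Positions are words of natural numbers. Children are numbered from `0`:
the `i`-th child of a node of rank `k` is reached by the letter `i < k`. -/
abbrev Pos := List ℕ

/-- The strict lexicographic order `v ≺ w` on positions in which prefixes are larger. -/
def Pos.LexLT : Pos → Pos → Prop
  | [], _ => False
  | _ :: _, [] => True
  | i :: v, j :: w => i < j ∨ (i = j ∧ Pos.LexLT v w)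

namespace RTree

variable {A : Type*} {rk : A → ℕ} {Z : Type*}

/-- The inclusion of `T_Σ` in `T_Σ(Z)`. -/
def embed : GTree rk → RTree rk Z
  | var z => z.elim
  | node a ts => node a fun i => embed (ts i)

/-- The subtree `t|_w`; it is `none` exactly if `w` is not a position of `t`. -/
def subtreeAt : RTree rk Z → Pos → Option (RTree rk Z)
  | t, [] => some t
  | var _, _ :: _ => none
  | node a ts, i :: w => if h : i < rk a then subtreeAt (ts ⟨i, h⟩) w else none

/-- The set `pos(t)` of positions of `t`. -/
def positions (t : RTree rk Z) : Set Pos := {w | (t.subtreeAt w).isSome}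

/-- The substitution `t[s]_w` of `s` into `t` at the position `w`. -/
def replaceAt : RTree rk Z → Pos → RTree rk Z → RTree rk Z
  | _, [], s => s
  | var z, _ :: _, _ => var z
  | node a ts, i :: w, s =>
      node a fun j => if (j : ℕ) = i then replaceAt (ts j) w s else ts j

/-- The height of a tree: the maximal length of its positions. -/
def height : RTree rk Z → ℕ
  | var _ => 0
  | node _ ts => Finset.univ.sup fun i => height (ts i) + 1

/-- The tree `t` carries the index `z` at the position `w`. -/
def HasIndexAt (t : RTree rk Z) (w : Pos) (z : Z) : Prop := t.subtreeAt w = some (var z)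

/-- The set `pos_Z(t)` of positions labeled by an index. -/
def indexPositions (t : RTree rk Z) : Set Pos := {w | ∃ z, t.HasIndexAt w z}

/-- The set `pos_Σ(t)` of positions labeled by a symbol of the alphabet. -/
def symbolPositions (t : RTree rk Z) : Set Pos :=
  {w | ∃ a ts, t.subtreeAt w = some (node a ts)}

/-- `t ⊨ E`: for every `(v, v') ∈ E`, both `v` and `v'` are positions of `t` and
`t|_v = t|_v'`. -/
def Satisfies (t : RTree rk Z) (E : Finset (Pos × Pos)) : Prop :=
  ∀ c ∈ E, ∃ s, t.subtreeAt c.1 = some s ∧ t.subtreeAt c.2 = some s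

theorem positions_finite (t : RTree rk Z) : t.positions.Finite := by
  induction t with
  | var z =>
    refine (Set.finite_singleton ([] : Pos)).subset ?_
    rintro (_ | ⟨i, w⟩) hw
    · rfl
    · simp [positions, subtreeAt] at hw
  | node a ts ih =>
    refine ((Set.finite_singleton ([] : Pos)).union
      (Set.finite_iUnion fun i : Fin (rk a) => (ih i).image (List.cons (i : ℕ)))).subset ?_
    rintro (_ | ⟨i, w⟩) hw
    · exact Or.inl rfl
    · by_cases h : i < rk a
      · refine Or.inr (Set.mem_iUnion.2 ⟨⟨i, h⟩, w, ?_, rfl⟩)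
        simpa [positions, subtreeAt, h] using hw
      · simp [positions, subtreeAt, h] at hw

end RTree

/-- A production `ℓ —E→ q` with states in `Q`. -/
structure Production {A : Type*} (rk : A → ℕ) (Q : Type*) where
  lhs : RTree rk Q
  target : Q
  constr : Finset (Pos × Pos)

/-- A weighted tree grammar with equality constraints with state set `Q`, over `ℕ`.
Only the values of `wt` on `prods` are relevant. -/
structure WTGc {A : Type*} (rk : A → ℕ) (Q : Type*) where
  final : Q → ℕ
  prods : Finset (Production rk Q)
  lhs_ne_state : ∀ p ∈ prods, ∀ q, p.lhs ≠ RTree.var q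
  wt : Production rk Q → ℕ

namespace WTGc

variable {A : Type*} {rk : A → ℕ} {Q : Type*}

/-- The derivation step `ξ ⇒ ζ` for the input tree `t` that applies `p` at position `w`. -/
def Step (G : WTGc rk Q) (t : GTree rk) (p : Production rk Q) (w : Pos)
    (ξ ζ : RTree rk Q) : Prop :=
  p ∈ G.prods ∧ ξ.subtreeAt w = some p.lhs ∧ ζ = ξ.replaceAt w (RTree.var p.target) ∧
    ∃ s, t.subtreeAt w = some s ∧ s.Satisfies p.constr

/-- The sequence `d` of productions and positions leads from `ξ` to `ζ`, for the
input tree `t`. -/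
def Run (G : WTGc rk Q) (t : GTree rk) :
    RTree rk Q → List (Production rk Q × Pos) → RTree rk Q → Prop
  | ξ, [], ζ => ξ = ζ
  | ξ, pw :: d, ζ => ∃ ξ', G.Step t pw.1 pw.2 ξ ξ' ∧ G.Run t ξ' d ζ

/-- The set `D_G^q(t)` of complete left-most derivations for `t` to `q`. -/
def derivations (G : WTGc rk Q) (q : Q) (t : GTree rk) :
    Set (List (Production rk Q × Pos)) :=
  {d | G.Run t t.embed d (RTree.var q) ∧ (d.map Prod.snd).Pairwise Pos.LexLT}

theorem Run.mem {G : WTGc rk Q} {t : GTree rk} {d : List (Production rk Q × Pos)} :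
    ∀ {ξ ζ : RTree rk Q}, G.Run t ξ d ζ →
      ∀ x ∈ d, x.1 ∈ G.prods ∧ x.2 ∈ t.positions := by
  induction d with
  | nil => intro ξ ζ _ x hx; simp at hx
  | cons y d ih =>
    rintro ξ ζ ⟨ξ', ⟨hp, _, _, s, hs, _⟩, hr⟩ x hx
    rcases List.mem_cons.1 hx with rfl | hx
    · exact ⟨hp, by simp [RTree.positions, hs]⟩
    · exact ih hr x hx

theorem lexLT_irrefl : ∀ w : Pos, ¬ Pos.LexLT w w
  | [] => by simp [Pos.LexLT]
  | i :: w => by simp [Pos.LexLT, lexLT_irrefl w]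

theorem derivations_finite (G : WTGc rk Q) (q : Q) (t : GTree rk) :
    (G.derivations q t).Finite := by
  classical
  have hfin : ((G.prods : Set (Production rk Q)) ×ˢ t.positions).Finite :=
    G.prods.finite_toSet.prod t.positions_finite
  let S := hfin.toFinset
  refine (Set.Finite.subset
    (S.powerset.biUnion fun U => U.val.lists.toFinset).finite_toSet ?_)
  rintro d ⟨hr, hp⟩
  have hnd : d.Nodup := by
    refine List.Nodup.of_map Prod.snd (hp.imp ?_)
    rintro a b hab rfl
    exact lexLT_irrefl a hab
  simp only [Finset.coe_biUnion, Set.mem_iUnion]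
  refine ⟨d.toFinset, ?_, ?_⟩
  · simp only [Finset.coe_powerset, Set.mem_preimage, Set.mem_powerset_iff]
    intro x hx
    have hx' : x ∈ d := by simpa using hx
    have := hr.mem x hx'
    simpa [S] using this
  · simp [List.toFinset_val, hnd.dedup, -List.coe_toFinset]

/-- The weight of a derivation: the product of the weights of its productions. -/
def derivationWt (G : WTGc rk Q) (d : List (Production rk Q × Pos)) : ℕ :=
  (d.map fun pw => G.wt pw.1).prod

/-- The weighted tree language generated by `G`. -/
noncomputable def sem [Fintype Q] (G : WTGc rk Q) (t : GTree rk) : ℕ :=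
  ∑ q : Q, ∑ d ∈ (G.derivations_finite q t).toFinset, G.final q * G.derivationWt d

/-- A weighted tree grammar: no production has equality constraints. -/
def IsWTG (G : WTGc rk Q) : Prop := ∀ p ∈ G.prods, p.constr = ∅

/-- A weighted tree automaton with constraints: the only position of a left-hand side
that is labeled by a symbol is the root. -/
def IsWTAc (G : WTGc rk Q) : Prop := ∀ p ∈ G.prods, p.lhs.symbolPositions = {[]}

/-- A weighted tree automaton. -/
def IsWTA (G : WTGc rk Q) : Prop := G.IsWTG ∧ G.IsWTAc

/-- The height of the set of productions. -/
def prodsHeight (G : WTGc rk Q) : ℕ := G.prods.sup fun p => p.lhs.height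

end WTGc

/-- A weighted tree language is regular if it is generated by a weighted tree automaton
(with finitely many states). -/
def IsRegular {A : Type*} {rk : A → ℕ} (φ : GTree rk → ℕ) : Prop :=
  ∃ (Q : Type) (_ : Fintype Q) (H : WTGc rk Q), H.IsWTA ∧ ∀ t, H.sem t = φ t

/-- The production `a(⊥, …, ⊥) → ⊥`. -/
def sinkProduction {A : Type*} (rk : A → ℕ) (Q : Type*) (a : A) :
    Production rk (WithBot Q) where
  lhs := RTree.node a fun _ => RTree.var ⊥
  target := ⊥
  constr := ∅

namespace WTGc

variable {A : Type*} {rk : A → ℕ} {Q : Type*}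

/-- A WTGh is a WTGc with state set `Q ∪ {⊥}`, where `⊥` is a nonfinal sink state and all
constraints are eq-restricted. -/
structure IsWTGh (G : WTGc rk (WithBot Q)) : Prop where
  final_bot : G.final ⊥ = 0
  sink_mem : ∀ a : A, sinkProduction rk Q a ∈ G.prods
  sink_wt : ∀ a : A, G.wt (sinkProduction rk Q a) = 1
  /-- The state `⊥` is a sink: only `⊥` leads to `⊥`. -/
  sink_only : ∀ p ∈ G.prods, p.target = ⊥ → ∀ w q, p.lhs.HasIndexAt w q → q = ⊥
  /-- Constraints relate state positions of the left-hand side. -/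
  constr_pos : ∀ p ∈ G.prods, ∀ c ∈ p.constr,
    c.1 ∈ p.lhs.indexPositions ∧ c.2 ∈ p.lhs.indexPositions
  /-- `E` is an equivalence relation on the set of the positions that occur in it. -/
  constr_refl : ∀ p ∈ G.prods, ∀ v w, (v, w) ∈ p.constr → (v, v) ∈ p.constr
  constr_symm : ∀ p ∈ G.prods, ∀ v w, (v, w) ∈ p.constr → (w, v) ∈ p.constr
  constr_trans : ∀ p ∈ G.prods, ∀ u v w,
    (u, v) ∈ p.constr → (v, w) ∈ p.constr → (u, w) ∈ p.constr
  /-- If `w` is the lexicographically least element of its class, then its state is not `⊥`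
  and all other elements of the class carry the state `⊥`. -/
  constr_guard : ∀ p ∈ G.prods, ∀ w, (w, w) ∈ p.constr →
    (∀ v, (w, v) ∈ p.constr → v ≠ w → Pos.LexLT w v) →
    ¬ p.lhs.HasIndexAt w ⊥ ∧ ∀ v, (w, v) ∈ p.constr → v ≠ w → p.lhs.HasIndexAt v ⊥

/-- A WTGh is trim if every production is used in some accepting derivation of nonzero
weight. The productions `a(⊥, …, ⊥) → ⊥`, which every WTGh has to contain, are exempt. -/
def IsTrim (G : WTGc rk (WithBot Q)) : Prop :=
  ∀ p ∈ G.prods, (∀ a : A, p ≠ sinkProduction rk Q a) →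
    ∃ (t : GTree rk) (q : WithBot Q), ∃ d ∈ G.derivations q t,
      G.final q * G.derivationWt d ≠ 0 ∧ p ∈ d.map Prod.fst

/-- The height `|Q| · he(P)` of a WTGh with state set `Q ∪ {⊥}`. -/
def height [Fintype Q] (G : WTGc rk (WithBot Q)) : ℕ := Fintype.card Q * G.prodsHeight

/-- The large duplication property. -/
def LargeDuplication [Fintype Q] (G : WTGc rk (WithBot Q)) : Prop :=
  ∃ p ∈ G.prods, ∃ u v, (u, v) ∈ p.constr ∧ p.lhs.HasIndexAt v ⊥ ∧
    ∃ q : WithBot Q, q ≠ ⊥ ∧ p.lhs.HasIndexAt u q ∧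
      ∃ t : GTree rk, G.height < t.height ∧ (G.derivations q t).Nonempty

end WTGc

end HomTree

/-! Let `r` be the state at the guard position `u` of the duplicating production `p`. A state that
accepts only finitely many trees accepts none of height above `G.height` (`height_le_of_finite`), so
`r` accepts infinitely many trees `s i`. By trimness `p` occurs in an accepting derivation of
nonzero weight; filling the constraint class of `u` with `s j`, and every class met above it with
equal copies, yields accepted trees `T j` that carry `s j` at one fixed position `x`. The object of
study is the matrix with entries ⟦G⟧(T j [s i] at x).

If ⟦G⟧ were regular, this matrix would have finite rank, since without constraints every entry is
built by sums and products from functions of `i` alone and of `j` alone (`IsWTG.finiteRank_sem`).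
With constraints, indicators of equalities between subtrees enter as well. The use of `p` above `x`
contributes only for `i = j`, because the copy of `s j` in the class of `u` is left unchanged. Other
productions could compensate for this only if some equality held generically off the diagonal but
failed on it. That is impossible (`diagGE_satisfies`), and weights in ℕ do not cancel.

"Generically" means: for almost all `i` and then almost all `j`, along a nonprincipal ultrafilter.
So the matrix agrees generically with a finite rank matrix `N` and strictly exceeds it on the
diagonal (`IsWTGh.hasDiagFamily_of_mem`). A finite rank matrix that vanishes generically vanishes at
almost every diagonal entry (`eventually_sum_mul_eq_zero`); applied to the difference with `N`, this
is a contradiction. -/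

namespace HomTree

/-! ### Left-most derivations and the recursion for their weights. -/

theorem lexLT_trans : ∀ u v w : Pos, Pos.LexLT u v → Pos.LexLT v w → Pos.LexLT u w
  | [], _, _ => by simp [Pos.LexLT]
  | _ :: _, [], _ => by simp [Pos.LexLT]
  | _ :: _, _ :: _, [] => by simp [Pos.LexLT]
  | i :: u, j :: v, k :: w => by
    have := lexLT_trans u v w
    simp only [Pos.LexLT]
    rintro (h | ⟨rfl, h⟩) (h' | ⟨rfl, h'⟩)
    · exact Or.inl (h.trans h')
    · exact Or.inl h
    · exact Or.inl h'
    · exact Or.inr ⟨rfl, this h h'⟩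

theorem lexLT_trichotomous : ∀ u v : Pos, Pos.LexLT u v ∨ u = v ∨ Pos.LexLT v u
  | [], [] => by simp
  | [], _ :: _ => by simp [Pos.LexLT]
  | _ :: _, [] => by simp [Pos.LexLT]
  | i :: u, j :: v => by
    have := lexLT_trichotomous u v
    simp only [Pos.LexLT, List.cons.injEq]
    rcases lt_trichotomy i j with h | rfl | h
    · simp [h]
    · simpa using this
    · simp [h]

/-- A strictly sorted list is determined by its set of entries. Splitting and joining of left-most
runs can therefore be checked on membership alone. -/
theorem eq_of_pairwise_lexLT {α : Type*} {d e : List (α × Pos)}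
    (hd : (d.map Prod.snd).Pairwise Pos.LexLT) (he : (e.map Prod.snd).Pairwise Pos.LexLT)
    (h : ∀ x, x ∈ d ↔ x ∈ e) : d = e := by
  have nodup : ∀ {l : List (α × Pos)}, (l.map Prod.snd).Pairwise Pos.LexLT → l.Nodup := by
    intro l hl
    refine List.Nodup.of_map Prod.snd (hl.imp ?_)
    rintro a b hab rfl
    exact WTGc.lexLT_irrefl a hab
  have hp : d.Perm e := (List.perm_ext_iff_of_nodup (nodup hd) (nodup he)).2 h
  rw [List.pairwise_map] at hd he
  refine hp.eq_of_pairwise ?_ hd he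
  intro a b _ _ hab hba
  exact (WTGc.lexLT_irrefl _ (lexLT_trans _ _ _ hab hba)).elim

namespace RTree

variable {A : Type*} {rk : A → ℕ} {Z : Type*}

@[simp] theorem subtreeAt_nil (t : RTree rk Z) : t.subtreeAt [] = some t := by
  cases t <;> rfl

@[simp] theorem replaceAt_nil (t s : RTree rk Z) : t.replaceAt [] s = s := by
  cases t <;> rfl

end RTree

namespace WTGc

variable {A : Type*} {rk : A → ℕ} {Q : Type*}

/-- The left-most runs on the input tree `t` that lead to the sentential form `ξ`. -/
def formDerivations (G : WTGc rk Q) (ξ : RTree rk Q) (t : GTree rk) :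
    Set (List (Production rk Q × Pos)) :=
  {d | G.Run t t.embed d ξ ∧ (d.map Prod.snd).Pairwise Pos.LexLT}

theorem formDerivations_finite (G : WTGc rk Q) (ξ : RTree rk Q) (t : GTree rk) :
    (G.formDerivations ξ t).Finite := by
  classical
  have hfin : ((G.prods : Set (Production rk Q)) ×ˢ t.positions).Finite :=
    G.prods.finite_toSet.prod t.positions_finite
  let S := hfin.toFinset
  refine (Set.Finite.subset
    (S.powerset.biUnion fun U => U.val.lists.toFinset).finite_toSet ?_)
  rintro d ⟨hr, hp⟩
  have hnd : d.Nodup := by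
    refine List.Nodup.of_map Prod.snd (hp.imp ?_)
    rintro a b hab rfl
    exact lexLT_irrefl a hab
  simp only [Finset.coe_biUnion, Set.mem_iUnion]
  refine ⟨d.toFinset, ?_, ?_⟩
  · simp only [Finset.coe_powerset, Set.mem_preimage, Set.mem_powerset_iff]
    intro x hx
    have hx' : x ∈ d := by simpa using hx
    have := hr.mem x hx'
    simpa [S] using this
  · simp [List.toFinset_val, hnd.dedup, -List.coe_toFinset]

/-- The total weight of the left-most runs on `t` that lead to `ξ`. -/
noncomputable def formWt (G : WTGc rk Q) (ξ : RTree rk Q) (t : GTree rk) : ℕ :=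
  ∑ d ∈ (G.formDerivations_finite ξ t).toFinset, G.derivationWt d

/-- The total weight of the complete left-most derivations for `t` to `q`. -/
noncomputable def val (G : WTGc rk Q) (q : Q) (t : GTree rk) : ℕ := G.formWt (RTree.var q) t

theorem sem_eq_sum_val [Fintype Q] (G : WTGc rk Q) (t : GTree rk) :
    G.sem t = ∑ q, G.final q * G.val q t := by
  simp only [sem, val, formWt, Finset.mul_sum]
  rfl

/-- The part of a run that takes place below the `i`-th child of the root. -/
def strip {α : Type*} (i : ℕ) (d : List (α × Pos)) : List (α × Pos) :=
  d.filterMap fun x => match x.2 with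
    | [] => none
    | j :: w => if j = i then some (x.1, w) else none

theorem mem_strip {α : Type*} {i : ℕ} {d : List (α × Pos)} {x : α × Pos} :
    x ∈ strip i d ↔ (x.1, i :: x.2) ∈ d := by
  simp only [strip, List.mem_filterMap]
  constructor
  · rintro ⟨⟨p, _ | ⟨j, w⟩⟩, h, h'⟩
    · simp at h'
    · simp only [Option.ite_none_right_eq_some, Option.some.injEq] at h'
      obtain ⟨rfl, rfl⟩ := h'
      exact h
  · intro h
    exact ⟨_, h, by simp⟩

theorem pairwise_strip {α : Type*} (i : ℕ) {d : List (α × Pos)}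
    (h : (d.map Prod.snd).Pairwise Pos.LexLT) :
    ((strip i d).map Prod.snd).Pairwise Pos.LexLT := by
  rw [List.pairwise_map] at h ⊢
  refine List.Pairwise.filterMap _ ?_ h
  rintro ⟨p, _ | ⟨j, w⟩⟩ ⟨p', _ | ⟨j', w'⟩⟩ hlt b hb b' hb' <;>
    simp only [Option.ite_none_right_eq_some, Option.some.injEq, reduceCtorEq] at hb hb'
  obtain ⟨rfl, rfl⟩ := hb
  obtain ⟨rfl, rfl⟩ := hb'
  simpa [Pos.LexLT] using hlt

/-- The concatenation of runs that take place below the children of the root. -/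
def joinRuns {α : Type*} {n : ℕ} (f : Fin n → List (α × Pos)) : List (α × Pos) :=
  (List.ofFn fun i => (f i).map fun x => (x.1, (i : ℕ) :: x.2)).flatten

theorem mem_joinRuns {α : Type*} {n : ℕ} {f : Fin n → List (α × Pos)} {x : α × Pos} :
    x ∈ joinRuns f ↔ ∃ i : Fin n, ∃ w, x.2 = (i : ℕ) :: w ∧ (x.1, w) ∈ f i := by
  simp only [joinRuns, List.mem_flatten, List.mem_ofFn]
  constructor
  · rintro ⟨_, ⟨i, rfl⟩, h⟩
    obtain ⟨y, hy, rfl⟩ := List.mem_map.1 h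
    exact ⟨i, y.2, rfl, hy⟩
  · rintro ⟨i, w, h, h'⟩
    exact ⟨_, ⟨i, rfl⟩, List.mem_map.2 ⟨_, h', by rw [← h]⟩⟩

theorem pairwise_joinRuns {α : Type*} {n : ℕ} {f : Fin n → List (α × Pos)}
    (h : ∀ i, ((f i).map Prod.snd).Pairwise Pos.LexLT) :
    ((joinRuns f).map Prod.snd).Pairwise Pos.LexLT := by
  simp only [List.pairwise_map] at h
  rw [List.pairwise_map, joinRuns, List.pairwise_flatten]
  constructor
  · intro l hl
    obtain ⟨i, rfl⟩ := List.mem_ofFn.1 hl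
    rw [List.pairwise_map]
    refine (h i).imp ?_
    intro a b hab
    simpa [Pos.LexLT] using hab
  · rw [List.pairwise_ofFn]
    intro i j hij x hx y hy
    obtain ⟨x, _, rfl⟩ := List.mem_map.1 hx
    obtain ⟨y, _, rfl⟩ := List.mem_map.1 hy
    exact Or.inl hij

theorem derivationWt_joinRuns (G : WTGc rk Q) {n : ℕ}
    (f : Fin n → List (Production rk Q × Pos)) :
    G.derivationWt (joinRuns f) = ∏ i, G.derivationWt (f i) := by
  simp only [derivationWt, joinRuns, List.map_flatten, List.prod_flatten, List.map_ofFn,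
    List.prod_ofFn]
  refine Finset.prod_congr rfl fun i _ => ?_
  simp [Function.comp_def]

theorem run_var {G : WTGc rk Q} {t : GTree rk} {q : Q} {d : List (Production rk Q × Pos)}
    {ζ : RTree rk Q} (h : G.Run t (RTree.var q) d ζ) : d = [] ∧ ζ = RTree.var q := by
  cases d with
  | nil => exact ⟨rfl, h.symm⟩
  | cons x d =>
    obtain ⟨ξ, ⟨hp, hs, -⟩, -⟩ := h
    rcases x with ⟨p, _ | ⟨i, w⟩⟩
    · simp only [RTree.subtreeAt, Option.some.injEq] at hs
      exact (G.lhs_ne_state p hp q hs.symm).elim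
    · simp [RTree.subtreeAt] at hs

theorem run_append {G : WTGc rk Q} {t : GTree rk} {d e : List (Production rk Q × Pos)} :
    ∀ {ξ ζ : RTree rk Q}, G.Run t ξ (d ++ e) ζ ↔ ∃ ξ', G.Run t ξ d ξ' ∧ G.Run t ξ' e ζ := by
  induction d with
  | nil => simp [Run]
  | cons x d ih =>
    intro ξ ζ
    simp only [List.cons_append, Run, ih]
    constructor
    · rintro ⟨a, h, b, h', h''⟩
      exact ⟨b, ⟨a, h, h'⟩, h''⟩
    · rintro ⟨b, ⟨a, h, h'⟩, h''⟩
      exact ⟨a, h, b, h', h''⟩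

theorem Run.ne_nil {G : WTGc rk Q} {t : GTree rk} {b : A} {ζs : Fin (rk b) → RTree rk Q}
    {d : List (Production rk Q × Pos)} :
    ∀ {ξ : RTree rk Q}, G.Run t ξ d (RTree.node b ζs) → ∀ x ∈ d, x.2 ≠ [] := by
  induction d with
  | nil => simp
  | cons y d ih =>
    rintro ξ ⟨ξ', hs, hr⟩ x hx
    rcases List.mem_cons.1 hx with rfl | hx
    · intro h
      obtain ⟨-, -, rfl, -⟩ := hs
      rw [h, RTree.replaceAt_nil] at hr
      simpa using (run_var hr).2
    · exact ih hr x hx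

/-- Steps below different children do not interact, and constraints are tested on the input tree
below the position of the step, so they are inherited by the children. -/
theorem run_node_iff {G : WTGc rk Q} {a : A} {ts : Fin (rk a) → GTree rk}
    {d : List (Production rk Q × Pos)} :
    ∀ {ξs : Fin (rk a) → RTree rk Q} {ζ : RTree rk Q}, (∀ x ∈ d, x.2 ≠ []) →
    (G.Run (RTree.node a ts) (RTree.node a ξs) d ζ ↔
      (∀ x ∈ d, ∃ i : Fin (rk a), ∃ w, x.2 = (i : ℕ) :: w) ∧
      ∃ ζs, ζ = RTree.node a ζs ∧ ∀ i : Fin (rk a), G.Run (ts i) (ξs i) (strip i d) (ζs i)) := by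
  induction d with
  | nil =>
    intro ξs ζ _
    simp only [Run, strip, List.filterMap_nil]
    constructor
    · rintro rfl
      exact ⟨by simp, ξs, rfl, fun _ => rfl⟩
    · rintro ⟨-, ζs, rfl, h⟩
      rw [funext h]
  | cons x d ih =>
    intro ξs ζ hne
    have hd : ∀ x ∈ d, x.2 ≠ [] := fun y hy => hne y (List.mem_cons_of_mem _ hy)
    rcases x with ⟨p, _ | ⟨k, w⟩⟩
    · exact (hne (p, []) (by simp) rfl).elim
    have hstep : ∀ i : ℕ, strip i ((p, k :: w) :: d) =
        if k = i then (p, w) :: strip i d else strip i d := by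
      intro i
      by_cases h : k = i <;> simp [strip, h]
    constructor
    · rintro ⟨ξ', ⟨hp, hs, rfl, s, hs', hsat⟩, hr⟩
      by_cases hk : k < rk a
      swap
      · simp [RTree.subtreeAt, hk] at hs
      simp only [RTree.subtreeAt, hk, dite_true] at hs hs'
      simp only [RTree.replaceAt] at hr
      obtain ⟨h1, ζs, rfl, h2⟩ := (ih hd).1 hr
      refine ⟨?_, ζs, rfl, ?_⟩
      · intro x hx
        rcases List.mem_cons.1 hx with rfl | hx
        · exact ⟨⟨k, hk⟩, w, rfl⟩
        · exact h1 x hx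
      · intro i
        rw [hstep]
        have h2i := h2 i
        split_ifs with hki
        · obtain rfl : i = ⟨k, hk⟩ := Fin.ext hki.symm
          simp only [if_true] at h2i
          exact ⟨_, ⟨hp, hs, rfl, s, hs', hsat⟩, h2i⟩
        · rwa [if_neg (Ne.symm hki)] at h2i
    · rintro ⟨h1, ζs, rfl, h2⟩
      obtain ⟨k', w', hkw⟩ := h1 _ (List.mem_cons_self ..)
      obtain ⟨rfl, rfl⟩ : k = k' ∧ w = w' := by simpa using hkw
      have hk := h2 k'
      rw [hstep, if_pos rfl] at hk
      obtain ⟨ξ', ⟨hp, hs, rfl, s, hs', hsat⟩, hr⟩ := hk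
      refine ⟨_, ⟨hp, ?_, rfl, s, ?_, hsat⟩, ?_⟩
      · simpa [RTree.subtreeAt] using hs
      · simpa [RTree.subtreeAt] using hs'
      · simp only [RTree.replaceAt]
        refine (ih hd).2 ⟨fun x hx => h1 x (List.mem_cons_of_mem _ hx), ζs, rfl, fun i => ?_⟩
        by_cases hki : (i : ℕ) = k'
        · obtain rfl : i = k' := Fin.ext hki
          simpa using hr
        · have h2i := h2 i
          rw [hstep, if_neg (Ne.symm hki)] at h2i
          simpa [hki] using h2i

theorem formDerivations_node_ne (G : WTGc rk Q) {a b : A} (hab : a ≠ b)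
    (ξs : Fin (rk a) → RTree rk Q) (ts : Fin (rk b) → GTree rk) :
    G.formDerivations (RTree.node a ξs) (RTree.node b ts) = ∅ := by
  refine Set.eq_empty_of_forall_notMem ?_
  rintro d ⟨hr, -⟩
  obtain ⟨-, ζs, h, -⟩ := (run_node_iff hr.ne_nil).1 hr
  cases h
  exact hab rfl

theorem mem_formDerivations_node {G : WTGc rk Q} {a : A}
    {ξs : Fin (rk a) → RTree rk Q} {ts : Fin (rk a) → GTree rk}
    {d : List (Production rk Q × Pos)} :
    d ∈ G.formDerivations (RTree.node a ξs) (RTree.node a ts) ↔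
      (∀ i : Fin (rk a), strip i d ∈ G.formDerivations (ξs i) (ts i)) ∧
        joinRuns (fun i : Fin (rk a) => strip i d) = d := by
  constructor
  · rintro ⟨hr, hp⟩
    obtain ⟨h1, ζs, h, h2⟩ := (run_node_iff hr.ne_nil).1 hr
    cases h
    refine ⟨fun i => ⟨h2 i, pairwise_strip _ hp⟩,
      eq_of_pairwise_lexLT (pairwise_joinRuns fun i => pairwise_strip _ hp) hp fun x => ?_⟩
    rw [mem_joinRuns]
    constructor
    · rintro ⟨i, w, h, h'⟩
      rw [mem_strip] at h'
      rwa [← h] at h'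
    · intro hx
      obtain ⟨i, w, h⟩ := h1 x hx
      refine ⟨i, w, h, mem_strip.2 ?_⟩
      rwa [← h]
  · rintro ⟨h, hj⟩
    have hd : ∀ x ∈ d, ∃ i : Fin (rk a), ∃ w, x.2 = (i : ℕ) :: w := by
      intro x hx
      rw [← hj, mem_joinRuns] at hx
      obtain ⟨i, w, h, -⟩ := hx
      exact ⟨i, w, h⟩
    refine ⟨(run_node_iff ?_).2 ⟨hd, ξs, rfl, fun i => (h i).1⟩, ?_⟩
    · intro x hx hx'
      obtain ⟨i, w, h⟩ := hd x hx
      simp [hx'] at h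
    · rw [← hj]
      exact pairwise_joinRuns fun i => (h i).2

theorem formWt_node_ne (G : WTGc rk Q) {a b : A} (hab : a ≠ b)
    (ξs : Fin (rk a) → RTree rk Q) (ts : Fin (rk b) → GTree rk) :
    G.formWt (RTree.node a ξs) (RTree.node b ts) = 0 := by
  refine Finset.sum_eq_zero fun d hd => ?_
  rw [Set.Finite.mem_toFinset, formDerivations_node_ne G hab] at hd
  exact hd.elim

theorem strip_joinRuns {α : Type*} {n : ℕ} {f : Fin n → List (α × Pos)}
    (h : ∀ i, ((f i).map Prod.snd).Pairwise Pos.LexLT) (i : Fin n) :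
    strip i (joinRuns f) = f i := by
  refine eq_of_pairwise_lexLT (pairwise_strip _ (pairwise_joinRuns h)) (h i) fun x => ?_
  rw [mem_strip, mem_joinRuns]
  constructor
  · rintro ⟨j, w, hw, hx⟩
    simp only [List.cons.injEq] at hw
    obtain ⟨hw, rfl⟩ := hw
    rwa [Fin.ext hw]
  · intro hx
    exact ⟨i, x.2, rfl, hx⟩

/-- Left-most runs to a form with a symbol at the root correspond bijectively to tuples of left-most
runs on the children, via `strip` and `joinRuns`. -/
theorem formWt_node (G : WTGc rk Q) {a : A}
    (ξs : Fin (rk a) → RTree rk Q) (ts : Fin (rk a) → GTree rk) :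
    G.formWt (RTree.node a ξs) (RTree.node a ts) = ∏ i, G.formWt (ξs i) (ts i) := by
  classical
  simp only [formWt]
  rw [Finset.prod_univ_sum]
  refine Finset.sum_nbij' (fun d (i : Fin (rk a)) => strip i d) joinRuns ?_ ?_ ?_ ?_ ?_
  · intro d hd
    rw [Set.Finite.mem_toFinset, mem_formDerivations_node] at hd
    simpa using hd.1
  · intro f hf
    have hf' : ∀ i, f i ∈ G.formDerivations (ξs i) (ts i) := by simpa using hf
    have := fun i => strip_joinRuns (fun i => (hf' i).2) i
    rw [Set.Finite.mem_toFinset, mem_formDerivations_node]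
    exact ⟨fun i => by rw [this]; exact hf' i, by simp only [this]⟩
  · intro d hd
    rw [Set.Finite.mem_toFinset, mem_formDerivations_node] at hd
    exact hd.2
  · intro f hf
    have hf' : ∀ i, f i ∈ G.formDerivations (ξs i) (ts i) := by simpa using hf
    exact funext fun i => strip_joinRuns (fun i => (hf' i).2) i
  · intro d hd
    rw [Set.Finite.mem_toFinset, mem_formDerivations_node] at hd
    rw [← derivationWt_joinRuns, hd.2]

/-- Prefixes are larger in the order, so the step at the root comes last. Only a replacement at the
root can produce a bare state. -/
theorem mem_formDerivations_var {G : WTGc rk Q} {q : Q} {t : GTree rk}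
    {d : List (Production rk Q × Pos)} :
    d ∈ G.formDerivations (RTree.var q) t ↔ ∃ p ∈ G.prods, p.target = q ∧
      t.Satisfies p.constr ∧ ∃ e ∈ G.formDerivations p.lhs t, e ++ [(p, [])] = d := by
  constructor
  · rintro ⟨hr, hp⟩
    rcases List.eq_nil_or_concat d with rfl | ⟨e, ⟨p, w⟩, rfl⟩
    · rcases t with z | ⟨a, ts⟩
      · exact z.elim
      · simp [Run, RTree.embed] at hr
    simp only [List.concat_eq_append] at hr hp ⊢
    obtain ⟨ξ, hr, ζ, ⟨hpm, hs, hζ, s, hs', hsat⟩, rfl⟩ := run_append.1 hr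
    simp only at hpm hs hs' hsat hζ
    have hw : w = [] := by
      rcases w with _ | ⟨i, w⟩
      · rfl
      · rcases ξ with z | ⟨a, ξs⟩
        · simp [RTree.subtreeAt] at hs
        · simp [RTree.replaceAt] at hζ
    subst hw
    simp only [RTree.subtreeAt, Option.some.injEq, RTree.replaceAt, RTree.var.injEq] at hs hs' hζ
    subst hs hs'
    refine ⟨p, hpm, hζ.symm, hsat, e, ⟨hr, ?_⟩, rfl⟩
    rw [List.map_append, List.pairwise_append] at hp
    exact hp.1
  · rintro ⟨p, hp, rfl, hsat, e, ⟨hr, he⟩, rfl⟩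
    refine ⟨run_append.2 ⟨_, hr, _, ⟨hp, RTree.subtreeAt_nil _, rfl, t,
      RTree.subtreeAt_nil _, hsat⟩, RTree.replaceAt_nil _ _⟩, ?_⟩
    rw [List.map_append, List.pairwise_append]
    refine ⟨he, by simp, ?_⟩
    intro v hv w hw
    obtain rfl : w = [] := by simpa using hw
    obtain ⟨x, hx, rfl⟩ := List.mem_map.1 hv
    have hne : x.2 ≠ [] := by
      rcases hl : p.lhs with z | ⟨a, ξs⟩
      · exact (G.lhs_ne_state p hp z hl).elim
      · rw [hl] at hr
        exact hr.ne_nil x hx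
    rcases hx2 : x.2 with _ | ⟨i, w⟩
    · exact (hne hx2).elim
    · trivial

open Classical in
theorem val_eq_sum (G : WTGc rk Q) (q : Q) (t : GTree rk) :
    G.val q t = ∑ p ∈ G.prods,
      if p.target = q ∧ t.Satisfies p.constr then G.wt p * G.formWt p.lhs t else 0 := by
  have hset : (G.formDerivations_finite (RTree.var q) t).toFinset =
      (G.prods.filter fun p => p.target = q ∧ t.Satisfies p.constr).biUnion fun p =>
        (G.formDerivations_finite p.lhs t).toFinset.image fun e => e ++ [(p, [])] := by
    ext d
    simp only [Set.Finite.mem_toFinset, mem_formDerivations_var, Finset.mem_biUnion,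
      Finset.mem_filter, Finset.mem_image, and_assoc]
  rw [val, formWt, hset, Finset.sum_biUnion, ← Finset.sum_filter]
  · refine Finset.sum_congr rfl fun p _ => ?_
    rw [Finset.sum_image, formWt, Finset.mul_sum]
    · refine Finset.sum_congr rfl fun d _ => ?_
      simp [derivationWt, mul_comm]
    · intro d _ e _ h
      simpa using h
  · intro p _ p' _ hne
    rw [Function.onFun, Finset.disjoint_left]
    rintro d hd hd'
    obtain ⟨e, -, rfl⟩ := Finset.mem_image.1 hd
    obtain ⟨e', -, h⟩ := Finset.mem_image.1 hd'
    have := List.append_inj_right' h rfl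
    simp only [List.cons.injEq, Prod.mk.injEq, and_true] at this
    exact hne this.symm

end WTGc
end HomTree

/-! ### Filling the state positions of a left-hand side with trees. -/

namespace HomTree

namespace RTree

variable {A : Type*} {rk : A → ℕ} {Q : Type*}

theorem subtreeAt_append (t : RTree rk Q) (u v : Pos) :
    t.subtreeAt (u ++ v) = (t.subtreeAt u).bind fun s => s.subtreeAt v := by
  induction u generalizing t with
  | nil => simp
  | cons i u ih =>
    rcases t with z | ⟨a, ts⟩
    · simp [subtreeAt]
    · by_cases h : i < rk a <;> simp [subtreeAt, h, ih]

theorem height_add_length_le {t s : RTree rk Q} {w : Pos} (h : t.subtreeAt w = some s) :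
    s.height + w.length ≤ t.height := by
  induction w generalizing t with
  | nil =>
    obtain rfl : t = s := by simpa using h
    simp
  | cons i w ih =>
    rcases t with z | ⟨a, ts⟩
    · simp [subtreeAt] at h
    · by_cases hi : i < rk a
      · simp only [subtreeAt, hi, dite_true] at h
        have h1 := ih h
        have h2 : (ts ⟨i, hi⟩).height + 1 ≤ (node a ts).height := by
          rw [height]
          exact Finset.le_sup (f := fun i => (ts i).height + 1) (Finset.mem_univ _)
        simp only [List.length_cons]
        omega
      · simp [subtreeAt, hi] at h

theorem HasIndexAt.unique {t : RTree rk Q} {w : Pos} {q r : Q} (h : t.HasIndexAt w q)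
    (h' : t.HasIndexAt w r) : q = r := by
  rw [HasIndexAt] at h h'
  simpa [h] using h'

theorem hasIndexAt_node {a : A} {ts : Fin (rk a) → RTree rk Q} {w : Pos} {q : Q} :
    (node a ts).HasIndexAt w q ↔
      ∃ (i : Fin (rk a)) (v : Pos), w = (i : ℕ) :: v ∧ (ts i).HasIndexAt v q := by
  rcases w with _ | ⟨k, w⟩
  · simp [HasIndexAt]
  · constructor
    · intro h
      by_cases hk : k < rk a
      · exact ⟨⟨k, hk⟩, w, rfl, by simpa [HasIndexAt, subtreeAt, hk] using h⟩
      · simp [HasIndexAt, subtreeAt, hk] at h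
    · rintro ⟨i, v, h, h'⟩
      obtain ⟨rfl, rfl⟩ : k = i ∧ w = v := by simpa using h
      simpa [HasIndexAt, subtreeAt] using h'

theorem hasIndexAt_var {q r : Q} {w : Pos} :
    (var r : RTree rk Q).HasIndexAt w q ↔ w = [] ∧ r = q := by
  rcases w with _ | ⟨k, w⟩
  · simp [HasIndexAt]
  · simp [HasIndexAt, subtreeAt]

theorem infinite_of_height_pos {t : GTree rk} (h : 0 < t.height) : Infinite (GTree rk) := by
  rcases t with z | ⟨a, ts⟩
  · exact z.elim
  have ha : 0 < rk a := by
    by_contra h0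
    have : IsEmpty (Fin (rk a)) := ⟨fun i => by have := i.2; omega⟩
    simp [height] at h
  let g : ℕ → GTree rk := Nat.rec (node a ts) fun _ s => node a fun _ => s
  have hg : StrictMono fun n => (g n).height := by
    refine strictMono_nat_of_lt_succ fun n => ?_
    change _ < (node a fun _ => g n).height
    have : (node a fun _ => g n).subtreeAt [0] = some (g n) := by simp [subtreeAt, ha]
    have := height_add_length_le this
    simp only [List.length_cons, List.length_nil] at this
    omega
  exact Infinite.of_injective g fun m n hmn => hg.injective (by simp only [hmn])

/-- The tree obtained from `ξ` by replacing the index at each position `y` by `f y`. -/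
def plug : RTree rk Q → (Pos → GTree rk) → GTree rk
  | var _, f => f []
  | node a ts, f => node a fun i => plug (ts i) fun w => f (i :: w)

theorem subtreeAt_plug {ξ : RTree rk Q} {y : Pos} {q : Q} (h : ξ.HasIndexAt y q)
    (f : Pos → GTree rk) : (ξ.plug f).subtreeAt y = some (f y) := by
  induction ξ generalizing y f with
  | var r =>
    obtain ⟨rfl, rfl⟩ := hasIndexAt_var.1 h
    simp [plug]
  | node a ts ih =>
    obtain ⟨i, v, rfl, h'⟩ := hasIndexAt_node.1 h
    simpa [plug, subtreeAt] using ih i h' _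

theorem replaceAt_plug {ξ : RTree rk Q} {y : Pos} {q : Q} (h : ξ.HasIndexAt y q)
    (f : Pos → GTree rk) (x : Pos) (s : GTree rk) :
    (ξ.plug f).replaceAt (y ++ x) s = ξ.plug (Function.update f y ((f y).replaceAt x s)) := by
  induction ξ generalizing y f with
  | var r =>
    obtain ⟨rfl, rfl⟩ := hasIndexAt_var.1 h
    simp [plug]
  | node a ts ih =>
    obtain ⟨i, v, rfl, h'⟩ := hasIndexAt_node.1 h
    simp only [plug, List.cons_append, replaceAt, node.injEq, heq_eq_eq, true_and]
    funext j
    split_ifs with hj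
    · obtain rfl : j = i := Fin.ext hj
      rw [ih j h']
      congr 1
      funext w
      simp [Function.update_apply]
    · congr 1
      funext w
      simp [hj]

theorem height_plug_le {ξ : RTree rk Q} {f : Pos → GTree rk} {B : ℕ}
    (h : ∀ y q, ξ.HasIndexAt y q → (f y).height ≤ B) : (ξ.plug f).height ≤ ξ.height + B := by
  induction ξ generalizing f with
  | var r => simpa [plug, height] using h [] r (hasIndexAt_var.2 ⟨rfl, rfl⟩)
  | node a ts ih =>
    rw [plug, height]
    refine Finset.sup_le fun i _ => ?_
    have h1 := ih i (f := fun w => f (i :: w)) fun y q hy =>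
      h _ q (hasIndexAt_node.2 ⟨i, y, rfl, hy⟩)
    have h2 : (ts i).height + 1 ≤ (node a ts).height := by
      rw [height]
      exact Finset.le_sup (f := fun i => (ts i).height + 1) (Finset.mem_univ _)
    omega

theorem satisfies_plug_iff {ξ : RTree rk Q} {f : Pos → GTree rk} {E : Finset (Pos × Pos)}
    (hE : ∀ c ∈ E, c.1 ∈ ξ.indexPositions ∧ c.2 ∈ ξ.indexPositions) :
    (ξ.plug f).Satisfies E ↔ ∀ c ∈ E, f c.1 = f c.2 := by
  refine forall₂_congr fun c hc => ?_
  obtain ⟨⟨q, hq⟩, ⟨r, hr⟩⟩ := hE c hc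
  rw [subtreeAt_plug hq, subtreeAt_plug hr]
  simp only [Option.some.injEq]
  constructor
  · rintro ⟨s, h, h'⟩
    rw [h, h']
  · intro h
    exact ⟨_, h, rfl⟩

end RTree

namespace WTGc

open RTree

section Plug

variable {A : Type*} {rk : A → ℕ} {Q : Type*}

theorem formWt_plug_pos {G : WTGc rk Q} {ξ : RTree rk Q} {f : Pos → GTree rk}
    (h : ∀ y q, ξ.HasIndexAt y q → 0 < G.val q (f y)) : 0 < G.formWt ξ (ξ.plug f) := by
  induction ξ generalizing f with
  | var r => exact h [] r (hasIndexAt_var.2 ⟨rfl, rfl⟩)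
  | node a ts ih =>
    rw [plug, formWt_node]
    exact Finset.prod_pos fun i _ => ih i fun y q hy =>
      h _ q (hasIndexAt_node.2 ⟨i, y, rfl, hy⟩)

theorem exists_plug_of_formWt_pos {G : WTGc rk Q} {ξ : RTree rk Q} {t : GTree rk}
    (h : 0 < G.formWt ξ t) :
    ∃ f, t = ξ.plug f ∧ ∀ y q, ξ.HasIndexAt y q → 0 < G.val q (f y) := by
  induction ξ generalizing t with
  | var r =>
    refine ⟨fun _ => t, rfl, fun y q hy => ?_⟩
    obtain ⟨-, rfl⟩ := hasIndexAt_var.1 hy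
    exact h
  | node a ξs ih =>
    rcases t with z | ⟨b, ts⟩
    · exact z.elim
    by_cases hab : a = b
    · subst hab
      rw [formWt_node] at h
      have h' : ∀ i, 0 < G.formWt (ξs i) (ts i) := fun i =>
        Nat.pos_of_ne_zero (Finset.prod_ne_zero_iff.1 h.ne' i (Finset.mem_univ _))
      choose f hf hf' using fun i => ih i (h' i)
      let g : Pos → GTree rk := fun w => match w with
        | [] => node a ts
        | k :: w => if hk : k < rk a then f ⟨k, hk⟩ w else node a ts
      refine ⟨g, ?_, fun y q hy => ?_⟩
      · rw [plug]
        congr 1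
        funext i
        simp only [g, i.2, dite_true]
        exact hf i
      · obtain ⟨i, v, rfl, hv⟩ := hasIndexAt_node.1 hy
        simpa only [g, i.2, dite_true] using hf' i v q hv
    · rw [formWt_node_ne G hab] at h
      exact (lt_irrefl _ h).elim

/-- The constant `c` is the product of the weights at the index positions other than `y`. -/
theorem formWt_plug_update (G : WTGc rk Q) {ξ : RTree rk Q} {y : Pos} {q : Q}
    (h : ξ.HasIndexAt y q) (f : Pos → GTree rk) :
    ∃ c, (∀ s, G.formWt ξ (ξ.plug (Function.update f y s)) = G.val q s * c) ∧
      ((∀ z r, ξ.HasIndexAt z r → z ≠ y → 0 < G.val r (f z)) → 0 < c) := by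
  induction ξ generalizing y f with
  | var r =>
    obtain ⟨rfl, rfl⟩ := hasIndexAt_var.1 h
    exact ⟨1, fun s => by simp [plug, val], fun _ => one_pos⟩
  | node a ts ih =>
    obtain ⟨i, v, rfl, h'⟩ := hasIndexAt_node.1 h
    obtain ⟨c, hc, hc'⟩ := ih i h' fun w => f (i :: w)
    refine ⟨c * ∏ j ∈ Finset.univ.erase i, G.formWt (ts j) ((ts j).plug fun w => f (j :: w)),
      fun s => ?_, fun hf => ?_⟩
    · rw [plug, formWt_node, ← Finset.mul_prod_erase _ _ (Finset.mem_univ i), ← mul_assoc, ← hc]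
      congr 1
      · congr 2
        funext w
        simp [Function.update_apply]
      · refine Finset.prod_congr rfl fun j hj => ?_
        congr 2
        funext w
        have hji : (j : ℕ) ≠ i := fun h => Finset.ne_of_mem_erase hj (Fin.ext h)
        simp [hji]
    · refine Nat.mul_pos (hc' fun z r hz hzv => ?_) (Finset.prod_pos fun j hj => ?_)
      · exact hf _ r (hasIndexAt_node.2 ⟨i, z, rfl, hz⟩) (by simpa using hzv)
      · refine formWt_plug_pos fun z r hz => hf _ r (hasIndexAt_node.2 ⟨j, z, rfl, hz⟩) ?_
        intro h
        exact Finset.ne_of_mem_erase hj (Fin.ext (List.cons.inj h).1)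

theorem hasIndexAt_lhs_ne_nil {G : WTGc rk Q} {p : Production rk Q} (hp : p ∈ G.prods) {y : Pos}
    {q : Q} (h : p.lhs.HasIndexAt y q) : y ≠ [] := by
  rintro rfl
  exact G.lhs_ne_state p hp q (by simpa [HasIndexAt] using h)

theorem val_pos_of_production {G : WTGc rk Q} {p : Production rk Q} (hp : p ∈ G.prods)
    (hwt : G.wt p ≠ 0) {t : GTree rk} (hs : t.Satisfies p.constr)
    (h : 0 < G.formWt p.lhs t) : 0 < G.val p.target t := by
  classical
  rw [val_eq_sum]
  refine Finset.sum_pos' (fun _ _ => Nat.zero_le _) ⟨p, hp, ?_⟩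
  rw [if_pos ⟨rfl, hs⟩]
  exact Nat.mul_pos (Nat.pos_of_ne_zero hwt) h

theorem exists_production_of_val_pos {G : WTGc rk Q} {q : Q} {t : GTree rk}
    (h : 0 < G.val q t) :
    ∃ p ∈ G.prods, p.target = q ∧ t.Satisfies p.constr ∧ 0 < G.formWt p.lhs t := by
  classical
  rw [val_eq_sum] at h
  obtain ⟨p, hp, hne⟩ := Finset.exists_ne_zero_of_sum_ne_zero h.ne'
  rw [ne_eq, ite_eq_right_iff, Classical.not_imp] at hne
  exact ⟨p, hp, hne.1.1, hne.1.2, Nat.pos_of_ne_zero (right_ne_zero_of_mul hne.2)⟩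

end Plug

/-! ### Constraint classes, and the height bound for states that accept finitely many trees. -/

variable {A : Type*} {rk : A → ℕ} {Q : Type*} {G : WTGc rk (WithBot Q)}

theorem wt_ne_zero_of_mem {R : Type*} {G : WTGc rk R} {d : List (Production rk R × Pos)}
    (h : G.derivationWt d ≠ 0) {x : Production rk R × Pos} (hx : x ∈ d) : G.wt x.1 ≠ 0 := by
  intro h0
  exact h (List.prod_eq_zero (List.mem_map.2 ⟨x, hx, h0⟩))

theorem IsTrim.wt_ne_zero (hG : G.IsWTGh) (htrim : G.IsTrim) {p : Production rk (WithBot Q)}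
    (hp : p ∈ G.prods) : G.wt p ≠ 0 := by
  by_cases h : ∃ a : A, p = sinkProduction rk Q a
  · obtain ⟨a, rfl⟩ := h
    rw [hG.sink_wt]
    exact one_ne_zero
  · obtain ⟨t, q, d, -, hne, hmem⟩ := htrim p hp (not_exists.1 h)
    obtain ⟨x, hx, rfl⟩ := List.mem_map.1 hmem
    exact wt_ne_zero_of_mem (right_ne_zero_of_mul hne) hx

theorem formWt_pos_of_mem {R : Type*} {G : WTGc rk R} (hwt : ∀ p ∈ G.prods, G.wt p ≠ 0)
    {ξ : RTree rk R} {t : GTree rk} {d : List (Production rk R × Pos)}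
    (hd : d ∈ G.formDerivations ξ t) : 0 < G.formWt ξ t := by
  refine Finset.sum_pos' (fun _ _ => Nat.zero_le _) ⟨d, by simpa using hd, ?_⟩
  refine Nat.pos_of_ne_zero (List.prod_ne_zero fun h => ?_)
  obtain ⟨x, hx, h0⟩ := List.mem_map.1 h
  exact hwt _ (hd.1.mem x hx).1 h0

theorem IsWTGh.val_bot_pos (hG : G.IsWTGh) (t : GTree rk) : 0 < G.val ⊥ t := by
  induction t with
  | var z => exact z.elim
  | node a ts ih =>
    refine val_pos_of_production (hG.sink_mem a) ?_ ?_ ?_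
    · rw [hG.sink_wt]
      exact one_ne_zero
    · intro c hc
      simp [sinkProduction] at hc
    · change 0 < G.formWt (RTree.node a fun _ => RTree.var ⊥) _
      rw [formWt_node]
      exact Finset.prod_pos fun i _ => ih i

/-- Every other position of the constraint class of `y` carries the sink state. -/
def IsGuard (p : Production rk (WithBot Q)) (y : Pos) : Prop :=
  ∀ z, (y, z) ∈ p.constr → z ≠ y → p.lhs.HasIndexAt z ⊥

theorem exists_lexLT_least {S : Finset Pos} (hS : S.Nonempty) :
    ∃ m ∈ S, ∀ z ∈ S, z ≠ m → Pos.LexLT m z := by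
  induction hS using Finset.Nonempty.cons_induction with
  | singleton a => exact ⟨a, by simp, by simp⟩
  | cons a S ha hS ih =>
    obtain ⟨m, hm, hmin⟩ := ih
    rcases lexLT_trichotomous a m with h | rfl | h
    · refine ⟨a, by simp, fun z hz hza => ?_⟩
      rcases Finset.mem_cons.1 hz with rfl | hz
      · exact (hza rfl).elim
      by_cases hzm : z = m
      · rwa [hzm]
      · exact lexLT_trans _ _ _ h (hmin z hz hzm)
    · exact (ha hm).elim
    · refine ⟨m, by simp [hm], fun z hz hzm => ?_⟩
      rcases Finset.mem_cons.1 hz with rfl | hz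
      · exact h
      · exact hmin z hz hzm

theorem IsWTGh.exists_guard (hG : G.IsWTGh) {p : Production rk (WithBot Q)} (hp : p ∈ G.prods)
    {y : Pos} (hy : (y, y) ∈ p.constr) :
    ∃ m q, (y, m) ∈ p.constr ∧ p.lhs.HasIndexAt m q ∧ q ≠ ⊥ ∧ IsGuard p m := by
  classical
  let S := (p.constr.filter fun c => c.1 = y).image Prod.snd
  have hS : ∀ z, z ∈ S ↔ (y, z) ∈ p.constr := by
    intro z
    simp only [S, Finset.mem_image, Finset.mem_filter]
    constructor
    · rintro ⟨⟨a, b⟩, ⟨h, rfl⟩, rfl⟩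
      exact h
    · intro h
      exact ⟨_, ⟨h, rfl⟩, rfl⟩
  obtain ⟨m, hm, hmin⟩ := exists_lexLT_least ⟨y, (hS y).2 hy⟩
  rw [hS] at hm
  have hmy := hG.constr_symm p hp _ _ hm
  obtain ⟨h1, h2⟩ := hG.constr_guard p hp m (hG.constr_refl p hp _ _ hmy)
    fun v hv hne => hmin v ((hS v).2 (hG.constr_trans p hp _ _ _ hm hv)) hne
  obtain ⟨q, hq⟩ := (hG.constr_pos p hp _ hm).2
  exact ⟨m, q, hm, hq, fun h => h1 (h ▸ hq), fun z hz hne => h2 z hz hne⟩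

/-- All positions of a class except its least one carry `⊥`, so a position with a proper state is
the least of its class, or unconstrained. -/
theorem IsWTGh.isGuard (hG : G.IsWTGh) {p : Production rk (WithBot Q)} (hp : p ∈ G.prods)
    {y : Pos} {q : WithBot Q} (hy : p.lhs.HasIndexAt y q) (hq : q ≠ ⊥) : IsGuard p y := by
  intro z hz hne
  obtain ⟨m, -, hm, -, -, hg⟩ := hG.exists_guard hp (hG.constr_refl p hp _ _ hz)
  by_cases hym : y = m
  · subst hym
    exact hg z hz hne
  · exact (hq (hy.unique (hg y (hG.constr_symm p hp _ _ hm) hym))).elim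

open Classical in
/-- The assignment `f` with the value `s` at `y` and `s'` on the rest of the class of `y`. -/
noncomputable def classFill (E : Finset (Pos × Pos)) (f : Pos → GTree rk) (y : Pos)
    (s' s : GTree rk) : Pos → GTree rk :=
  Function.update (fun z => if (y, z) ∈ E then s' else f z) y s

@[simp] theorem classFill_self (E : Finset (Pos × Pos)) (f : Pos → GTree rk) (y : Pos)
    (s' s : GTree rk) : classFill E f y s' s y = s := by
  simp [classFill]

theorem classFill_pos (hG : G.IsWTGh) {p : Production rk (WithBot Q)} {f : Pos → GTree rk}
    {y : Pos} (hg : IsGuard p y) (hf : ∀ z r, p.lhs.HasIndexAt z r → 0 < G.val r (f z))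
    (s' s : GTree rk) {z : Pos} {r : WithBot Q} (hz : p.lhs.HasIndexAt z r) (hne : z ≠ y) :
    0 < G.val r (classFill p.constr f y s' s z) := by
  rw [classFill, Function.update_of_ne hne]
  split_ifs with h
  · rw [hz.unique (hg z h hne)]
    exact hG.val_bot_pos _
  · exact hf z r hz

theorem classFill_satisfies (hG : G.IsWTGh) {p : Production rk (WithBot Q)} (hp : p ∈ G.prods)
    {f : Pos → GTree rk} (hf : (p.lhs.plug f).Satisfies p.constr) (y : Pos) (s : GTree rk) :
    (p.lhs.plug (classFill p.constr f y s s)).Satisfies p.constr := by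
  rw [satisfies_plug_iff (hG.constr_pos p hp)] at hf ⊢
  have key : ∀ a b, (a, b) ∈ p.constr → (a = y ∨ (y, a) ∈ p.constr) → (y, b) ∈ p.constr := by
    rintro a b hab (rfl | h)
    · exact hab
    · exact hG.constr_trans p hp _ _ _ h hab
  have hval : ∀ a, (a = y ∨ (y, a) ∈ p.constr) → classFill p.constr f y s s a = s := by
    rintro a (rfl | h)
    · simp
    · by_cases hay : a = y
      · simp [hay]
      · simp [classFill, hay, h]
  have hval' : ∀ a, ¬ (a = y ∨ (y, a) ∈ p.constr) → classFill p.constr f y s s a = f a := by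
    intro a ha
    rw [not_or] at ha
    simp [classFill, ha.1, ha.2]
  rintro ⟨a, b⟩ hab
  by_cases ha : a = y ∨ (y, a) ∈ p.constr
  · rw [hval a ha, hval b (Or.inr (key a b hab ha))]
  · have hb : ¬ (b = y ∨ (y, b) ∈ p.constr) := fun hb =>
      ha (Or.inr (key b a (hG.constr_symm p hp _ _ hab) hb))
    rw [hval' a ha, hval' b hb]
    exact hf _ hab

/-- The subtree at a guard may be exchanged for any tree accepted by its state: the rest of the
class is exchanged along with it, and `⊥` accepts every tree. -/
theorem val_classFill_pos (hG : G.IsWTGh) (hwt : ∀ p ∈ G.prods, G.wt p ≠ 0)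
    {p : Production rk (WithBot Q)} (hp : p ∈ G.prods) {f : Pos → GTree rk}
    (hsat : (p.lhs.plug f).Satisfies p.constr)
    (hf : ∀ z r, p.lhs.HasIndexAt z r → 0 < G.val r (f z)) {y : Pos} {q : WithBot Q}
    (hy : p.lhs.HasIndexAt y q) (hg : IsGuard p y) {s : GTree rk} (hs : 0 < G.val q s) :
    0 < G.val p.target (p.lhs.plug (classFill p.constr f y s s)) := by
  refine val_pos_of_production hp (hwt p hp) (classFill_satisfies hG hp hsat y s)
    (formWt_plug_pos fun z r hz => ?_)
  by_cases hzy : z = y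
  · subst hzy
    rw [classFill_self]
    rwa [hz.unique hy]
  · exact classFill_pos hG hg hf s s hz hzy

/-- By exchanging subtrees at guards, a state with finite support forces each guard state below it
to have finite support and strictly smaller maximal height. Along a path the proper states thus
cannot repeat, and each contributes at most one left-hand side to the height. -/
theorem height_le_of_finite [Fintype Q] (hG : G.IsWTGh) (hwt : ∀ p ∈ G.prods, G.wt p ≠ 0)
    (hinf : Infinite (GTree rk)) {q : Q} (hfin : {t : GTree rk | 0 < G.val q t}.Finite) {t : GTree rk}
    (ht : 0 < G.val q t) : t.height ≤ G.height := by
  classical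
  -- On an unbounded set `sSup` is `0`. This is harmless: such states can only enlarge the sets `S
  -- q`, and all that matters is that `S` shrinks strictly when `h` drops.
  let h : Q → ℕ := fun q => sSup (RTree.height '' {t : GTree rk | 0 < G.val q t})
  let S : Q → Finset Q := fun q => Finset.univ.filter fun r => h r ≤ h q
  have hle : ∀ {q : Q}, {t : GTree rk | 0 < G.val q t}.Finite → ∀ {t : GTree rk}, 0 < G.val q t → t.height ≤ h q :=
    fun hfin t ht => le_csSup (hfin.image _).bddAbove ⟨t, ht, rfl⟩
  have main : ∀ n, ∀ q : Q, h q = n → {t : GTree rk | 0 < G.val q t}.Finite →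
      ∀ t : GTree rk, 0 < G.val q t →
      t.height ≤ (S q).card * G.prodsHeight := by
    intro n
    induction n using Nat.strong_induction_on with
    | _ n ih =>
    rintro q rfl hfin t ht
    obtain ⟨p, hp, htar, hsat, hform⟩ := exists_production_of_val_pos ht
    obtain ⟨f, rfl, hf⟩ := exists_plug_of_formWt_pos hform
    have hM : p.lhs.height ≤ G.prodsHeight :=
      Finset.le_sup (f := fun p : Production rk (WithBot Q) => p.lhs.height) hp
    have hq : q ∈ S q := by simp [S]
    have hguard : ∀ y r, p.lhs.HasIndexAt y r → IsGuard p y →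
        {t : GTree rk | 0 < G.val r t}.Finite ∧ ∀ s, 0 < G.val r s → s.height < h q := by
      intro y r hy hg
      have hpos : ∀ s, 0 < G.val r s →
          0 < G.val q (p.lhs.plug (classFill p.constr f y s s)) := by
        intro s hs
        rw [← htar]
        exact val_classFill_pos hG hwt hp hsat hf hy hg hs
      have hsub : ∀ s, (p.lhs.plug (classFill p.constr f y s s)).subtreeAt y = some s := by
        intro s
        rw [subtreeAt_plug hy, classFill_self]
      constructor
      · refine Set.Finite.of_finite_image (f := fun s => p.lhs.plug (classFill p.constr f y s s))
          (hfin.subset ?_) ?_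
        · rintro _ ⟨s, hs, rfl⟩
          exact hpos s hs
        · intro s _ s' _ hss
          have h1 := hsub s
          simp only at hss
          rw [hss, hsub s'] at h1
          exact (Option.some.inj h1).symm
      · intro s hs
        have h1 := height_add_length_le (hsub s)
        have h2 := hle hfin (hpos s hs)
        have h3 := List.length_pos_of_ne_nil (hasIndexAt_lhs_ne_nil hp hy)
        omega
    have hchild : ∀ y r, r ≠ ⊥ → p.lhs.HasIndexAt y r → IsGuard p y →
        (f y).height ≤ ((S q).card - 1) * G.prodsHeight := by
      intro y r hr hy hg
      obtain ⟨r, rfl⟩ := WithBot.ne_bot_iff_exists.1 hr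
      obtain ⟨h1, h2⟩ := hguard y _ hy hg
      have hlt : h r < h q := by
        have hpos := h2 _ (hf y _ hy)
        have : h r ≤ h q - 1 := by
          refine csSup_le ⟨_, f y, hf y _ hy, rfl⟩ ?_
          rintro _ ⟨s, hs, rfl⟩
          have := h2 s hs
          omega
        omega
      refine (ih _ hlt r rfl h1 _ (hf y _ hy)).trans (Nat.mul_le_mul_right _ ?_)
      refine Nat.le_sub_one_of_lt (Finset.card_lt_card ?_)
      refine Finset.ssubset_iff_of_subset (fun x hx => ?_) |>.2 ⟨q, hq, by simp [S, hlt]⟩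
      have : h x ≤ h r := by simpa [S] using hx
      simpa [S] using this.trans hlt.le
    have hbound : ∀ y r, p.lhs.HasIndexAt y r →
        (f y).height ≤ ((S q).card - 1) * G.prodsHeight := by
      intro y r hy
      by_cases hr : r = ⊥
      · subst hr
        -- A constrained `⊥` carries the same subtree as the guard of its class. An unconstrained
        -- `⊥` is vacuously a guard and would accept only finitely many trees, although it accepts
        -- all of them.
        by_cases hyy : (y, y) ∈ p.constr
        · obtain ⟨m, r, hm, hr, hrb, hg⟩ := hG.exists_guard hp hyy
          rw [(satisfies_plug_iff (hG.constr_pos p hp)).1 hsat _ hm]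
          exact hchild m r hrb hr hg
        · refine (Set.infinite_univ (α := GTree rk) ((hguard y ⊥ hy ?_).1.subset ?_)).elim
          · intro z hz
            exact (hyy (hG.constr_refl p hp _ _ hz)).elim
          · intro s _
            exact hG.val_bot_pos s
      · exact hchild y r hr hy (hG.isGuard hp hy hr)
    have hcard : 0 < (S q).card := Finset.card_pos.2 ⟨q, hq⟩
    calc (p.lhs.plug f).height ≤ p.lhs.height + ((S q).card - 1) * G.prodsHeight :=
          height_plug_le hbound
      _ ≤ (1 + ((S q).card - 1)) * G.prodsHeight := by
          rw [add_mul, one_mul]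
          exact Nat.add_le_add_right hM _
      _ = (S q).card * G.prodsHeight := by
          congr 1
          omega
  exact (main _ q rfl hfin t ht).trans (Nat.mul_le_mul_right _ (Finset.card_le_univ _))

end WTGc
end HomTree

/-! ### Matrices of finite rank and their diagonals along an ultrafilter. -/

namespace HomTree

section TwoVariables

variable {I : Type*}

/-- A class of functions of two variables that contains the functions of one variable and is
closed under sums and products. -/
structure IsSemiringClass (C : (I → I → ℕ) → Prop) : Prop where
  left : ∀ a : I → ℕ, C fun i _ => a i
  right : ∀ b : I → ℕ, C fun _ j => b j
  add : ∀ {f g}, C f → C g → C fun i j => f i j + g i j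
  mul : ∀ {f g}, C f → C g → C fun i j => f i j * g i j

theorem IsSemiringClass.sum {C : (I → I → ℕ) → Prop} (hC : IsSemiringClass C) {κ : Type*}
    (S : Finset κ) {f : κ → I → I → ℕ} (h : ∀ k ∈ S, C (f k)) :
    C fun i j => ∑ k ∈ S, f k i j := by
  induction S using Finset.cons_induction with
  | empty => simpa using hC.left fun _ => 0
  | cons k S hk ih =>
    simp only [Finset.sum_cons]
    exact hC.add (h k (by simp)) (ih fun l hl => h l (by simp [hl]))

theorem IsSemiringClass.prod {C : (I → I → ℕ) → Prop} (hC : IsSemiringClass C) {κ : Type*}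
    (S : Finset κ) {f : κ → I → I → ℕ} (h : ∀ k ∈ S, C (f k)) :
    C fun i j => ∏ k ∈ S, f k i j := by
  induction S using Finset.cons_induction with
  | empty => simpa using hC.left fun _ => 1
  | cons k S hk ih =>
    simp only [Finset.prod_cons]
    exact hC.mul (h k (by simp)) (ih fun l hl => h l (by simp [hl]))

/-- The matrix `f` has finite rank. -/
def FiniteRank (f : I → I → ℕ) : Prop :=
  ∃ (κ : Type) (_ : Fintype κ) (a b : κ → I → ℕ), ∀ i j, f i j = ∑ k, a k i * b k j

theorem finiteRank_isSemiringClass : IsSemiringClass (FiniteRank (I := I)) where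
  left a := ⟨Unit, inferInstance, fun _ => a, fun _ _ => 1, by simp⟩
  right b := ⟨Unit, inferInstance, fun _ _ => 1, fun _ => b, by simp⟩
  add := by
    rintro f g ⟨κ, _, a, b, h⟩ ⟨κ', _, a', b', h'⟩
    exact ⟨κ ⊕ κ', inferInstance, Sum.elim a a', Sum.elim b b', fun i j => by simp [h, h']⟩
  mul := by
    rintro f g ⟨κ, _, a, b, h⟩ ⟨κ', _, a', b', h'⟩
    refine ⟨κ × κ', inferInstance, fun k i => a k.1 i * a' k.2 i, fun k j => b k.1 j * b' k.2 j,
      fun i j => ?_⟩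
    beta_reduce
    rw [h, h', Finset.sum_mul_sum, Fintype.sum_prod_type]
    exact Finset.sum_congr rfl fun k _ => Finset.sum_congr rfl fun l _ => by ring

/-- Along `U`, the matrix `f` agrees off the diagonal with a matrix of finite rank, and is at
least as large on the diagonal. -/
def DiagGE (U : Ultrafilter I) (f : I → I → ℕ) : Prop :=
  ∃ N, FiniteRank N ∧ (∀ᶠ i in U, ∀ᶠ j in U, f i j = N i j) ∧ ∀ᶠ i in U, N i i ≤ f i i

/-- Along `U`, the matrix `f` agrees off the diagonal with a matrix of finite rank, and is
larger on the diagonal. -/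
def DiagGT (U : Ultrafilter I) (f : I → I → ℕ) : Prop :=
  ∃ N, FiniteRank N ∧ (∀ᶠ i in U, ∀ᶠ j in U, f i j = N i j) ∧ ∀ᶠ i in U, N i i < f i i

theorem FiniteRank.diagGE {U : Ultrafilter I} {f : I → I → ℕ} (h : FiniteRank f) :
    DiagGE U f :=
  ⟨f, h, by simp, by simp⟩

/-- Addition and multiplication in ℕ are monotone, so the inequality on the diagonal survives both.
-/
theorem diagGE_isSemiringClass (U : Ultrafilter I) : IsSemiringClass (DiagGE U) where
  left a := (finiteRank_isSemiringClass.left a).diagGE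
  right b := (finiteRank_isSemiringClass.right b).diagGE
  add := by
    rintro f g ⟨N, hN, h, hd⟩ ⟨N', hN', h', hd'⟩
    refine ⟨_, finiteRank_isSemiringClass.add hN hN', ?_, ?_⟩
    · filter_upwards [h, h'] with i hi hi'
      filter_upwards [hi, hi'] with j hj hj'
      rw [hj, hj']
    · filter_upwards [hd, hd'] with i hi hi'
      exact Nat.add_le_add hi hi'
  mul := by
    rintro f g ⟨N, hN, h, hd⟩ ⟨N', hN', h', hd'⟩
    refine ⟨_, finiteRank_isSemiringClass.mul hN hN', ?_, ?_⟩
    · filter_upwards [h, h'] with i hi hi'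
      filter_upwards [hi, hi'] with j hj hj'
      rw [hj, hj']
    · filter_upwards [hd, hd'] with i hi hi'
      exact Nat.mul_le_mul hi hi'

theorem DiagGT.add_diagGE {U : Ultrafilter I} {f g : I → I → ℕ} (hf : DiagGT U f)
    (hg : DiagGE U g) : DiagGT U fun i j => f i j + g i j := by
  obtain ⟨N, hN, h, hd⟩ := hf
  obtain ⟨N', hN', h', hd'⟩ := hg
  refine ⟨_, finiteRank_isSemiringClass.add hN hN', ?_, ?_⟩
  · filter_upwards [h, h'] with i hi hi'
    filter_upwards [hi, hi'] with j hj hj'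
    rw [hj, hj']
  · filter_upwards [hd, hd'] with i hi hi'
    exact Nat.add_lt_add_of_lt_of_le hi hi'

theorem DiagGT.mul_diagGE {U : Ultrafilter I} {f g : I → I → ℕ} (hf : DiagGT U f)
    (hg : DiagGE U g) (hpos : ∀ i, 0 < g i i) : DiagGT U fun i j => f i j * g i j := by
  obtain ⟨N, hN, h, hd⟩ := hf
  obtain ⟨N', hN', h', hd'⟩ := hg
  refine ⟨_, finiteRank_isSemiringClass.mul hN hN', ?_, ?_⟩
  · filter_upwards [h, h'] with i hi hi'
    filter_upwards [hi, hi'] with j hj hj'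
    rw [hj, hj']
  · filter_upwards [hd, hd'] with i hi hi'
    exact Nat.mul_lt_mul_of_lt_of_le hi hi' (hpos i)

-- An ultrafilter decides whether `P` holds generically, so the off-diagonal pattern is the constant
-- `1` or `0`. Only in the first case does the diagonal need an argument.
open Classical in
theorem diagGE_indicator {U : Ultrafilter I} {P : I → I → Prop}
    (h : (∀ᶠ i in U, ∀ᶠ j in U, P i j) → ∀ᶠ i in U, P i i) :
    DiagGE U fun i j => if P i j then 1 else 0 := by
  by_cases hP : ∀ᶠ i in U, ∀ᶠ j in U, P i j
  · refine ⟨_, finiteRank_isSemiringClass.left fun _ => 1, ?_, ?_⟩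
    · filter_upwards [hP] with i hi
      filter_upwards [hi] with j hj
      simp [hj]
    · filter_upwards [h hP] with i hi
      simp [hi]
  · refine ⟨_, finiteRank_isSemiringClass.left fun _ => 0, ?_, by simp⟩
    rw [← Ultrafilter.eventually_not] at hP
    filter_upwards [hP] with i hi
    rw [← Ultrafilter.eventually_not] at hi
    filter_upwards [hi] with j hj
    simp [hj]

/-- The vectors orthogonal to `b j` for almost all `j` form a space `V` of finite dimension. Almost
every `b i` is orthogonal to a finite generating set, hence to all of `V`, and almost every `a i`
lies in `V`. -/
theorem eventually_sum_mul_eq_zero {κ : Type*} [Fintype κ] {U : Filter I} {a b : κ → I → ℚ}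
    (h : ∀ᶠ i in U, ∀ᶠ j in U, ∑ k, a k i * b k j = 0) :
    ∀ᶠ i in U, ∑ k, a k i * b k i = 0 := by
  let ker : I → Submodule ℚ (κ → ℚ) := fun j =>
    LinearMap.ker (∑ k, b k j • LinearMap.proj (R := ℚ) (φ := fun _ : κ => ℚ) k)
  have hker : ∀ v j, v ∈ ker j ↔ ∑ k, v k * b k j = 0 := by
    intro v j
    simp [ker, mul_comm]
  let V : Submodule ℚ (κ → ℚ) :=
    { carrier := {v | ∀ᶠ j in U, v ∈ ker j}
      zero_mem' := by simp
      add_mem' := by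
        intro v w hv hw
        filter_upwards [hv, hw] with j hj hj'
        exact add_mem hj hj'
      smul_mem' := by
        intro c v hv
        filter_upwards [hv] with j hj
        exact Submodule.smul_mem _ c hj }
  obtain ⟨S, hS⟩ := (IsNoetherian.noetherian V : V.FG)
  have hSV : ∀ v ∈ S, ∀ᶠ j in U, v ∈ ker j := fun v hv => by
    have : v ∈ V := hS ▸ Submodule.subset_span hv
    exact this
  filter_upwards [h, (Filter.eventually_all_finset S).2 hSV] with i hi hi'
  have hle : V ≤ ker i := by
    rw [← hS, Submodule.span_le]
    exact hi'
  refine (hker (fun k => a k i) i).1 (hle ?_)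
  filter_upwards [hi] with j hj
  exact (hker _ _).2 hj

/-- Over ℚ the difference `f - N` has finite rank and vanishes generically, hence also at almost
every diagonal entry. -/
theorem FiniteRank.not_diagGT {U : Ultrafilter I} {f : I → I → ℕ} (hf : FiniteRank f) :
    ¬ DiagGT U f := by
  rintro ⟨N, ⟨κ', _, a', b', hN⟩, h, hd⟩
  obtain ⟨κ, _, a, b, hf⟩ := hf
  have key := eventually_sum_mul_eq_zero (U := (U : Filter I))
    (a := Sum.elim (fun k i => (a k i : ℚ)) fun k i => (a' k i : ℚ))
    (b := Sum.elim (fun k i => (b k i : ℚ)) fun k i => -(b' k i : ℚ))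
  have hsum : ∀ i j, ∑ k, Sum.elim (fun k i => (a k i : ℚ)) (fun k i => (a' k i : ℚ)) k i *
      Sum.elim (fun k i => (b k i : ℚ)) (fun k i => -(b' k i : ℚ)) k j = f i j - N i j := by
    intro i j
    rw [hf, hN]
    simp [sub_eq_add_neg]
  simp only [hsum, sub_eq_zero, Nat.cast_inj] at key
  obtain ⟨i, hi, hi'⟩ := ((key h).and hd).exists
  exact hi'.ne' hi

end TwoVariables

/-! ### Substitution at a position, and weights as matrices in two variables. -/

namespace RTree

variable {A : Type*} {rk : A → ℕ} {Z : Type*}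

theorem subtreeAt_replaceAt_append {t : RTree rk Z} {x : Pos} (hx : x ∈ t.positions)
    (s : RTree rk Z) (z : Pos) : (t.replaceAt x s).subtreeAt (x ++ z) = s.subtreeAt z := by
  induction x generalizing t with
  | nil => simp
  | cons i x ih =>
    rcases t with v | ⟨a, ts⟩
    · simp [positions, subtreeAt] at hx
    · by_cases hi : i < rk a
      · have : x ∈ (ts ⟨i, hi⟩).positions := by simpa [positions, subtreeAt, hi] using hx
        simpa [replaceAt, subtreeAt, hi] using ih this
      · simp [positions, subtreeAt, hi] at hx

theorem subtreeAt_replaceAt_prefix (t s : RTree rk Z) (c x : Pos) :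
    (t.replaceAt (c ++ x) s).subtreeAt c = (t.subtreeAt c).map fun u => u.replaceAt x s := by
  induction c generalizing t with
  | nil => simp
  | cons i c ih =>
    rcases t with v | ⟨a, ts⟩
    · simp [replaceAt, subtreeAt]
    · by_cases hi : i < rk a
      · simpa [replaceAt, subtreeAt, hi] using ih _
      · simp [replaceAt, subtreeAt, hi]

theorem subtreeAt_replaceAt_of_not_prefix (t s : RTree rk Z) {c x : Pos} (h : ¬ c <+: x)
    (h' : ¬ x <+: c) : (t.replaceAt x s).subtreeAt c = t.subtreeAt c := by
  induction c generalizing t x with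
  | nil => simp at h
  | cons i c ih =>
    rcases x with _ | ⟨k, x⟩
    · simp at h'
    rcases t with v | ⟨a, ts⟩
    · simp [replaceAt]
    · by_cases hi : i < rk a
      · by_cases hik : i = k
        · subst hik
          simp only [List.cons_prefix_cons, true_and] at h h'
          simpa [replaceAt, subtreeAt, hi] using ih _ h h'
        · simp [replaceAt, subtreeAt, hi, hik]
      · simp [replaceAt, subtreeAt, hi]

theorem replaceAt_of_notMem {t : RTree rk Z} {x : Pos} (hx : x ∉ t.positions)
    (s : RTree rk Z) : t.replaceAt x s = t := by
  induction x generalizing t with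
  | nil => simp [positions] at hx
  | cons i x ih =>
    rcases t with v | ⟨a, ts⟩
    · simp [replaceAt]
    · simp only [replaceAt, node.injEq, heq_eq_eq, true_and]
      funext j
      split_ifs with hj
      · subst hj
        exact ih (by simpa [positions, subtreeAt] using hx)
      · rfl

theorem replaceAt_self {t s : RTree rk Z} {x : Pos} (hx : t.subtreeAt x = some s) :
    t.replaceAt x s = t := by
  induction x generalizing t with
  | nil => simpa using hx.symm
  | cons i x ih =>
    rcases t with v | ⟨a, ts⟩
    · simp [replaceAt]
    · simp only [replaceAt, node.injEq, heq_eq_eq, true_and]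
      funext j
      split_ifs with hj
      · subst hj
        exact ih (by simpa [subtreeAt] using hx)
      · rfl

theorem HasIndexAt.eq_of_prefix {t : RTree rk Z} {c c' : Pos} {q r : Z} (h : t.HasIndexAt c q)
    (h' : t.HasIndexAt c' r) (hp : c <+: c') : c = c' := by
  obtain ⟨z, rfl⟩ := hp
  rw [HasIndexAt] at h h'
  rw [subtreeAt_append, h, Option.bind_some] at h'
  obtain ⟨rfl, -⟩ := hasIndexAt_var.1 h'
  simp

/-- The symbol at the root. -/
def rootSymbol : GTree rk → A
  | var z => z.elim
  | node a _ => a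

/-- The `k`-th child of the root, with a junk value if there is none. -/
def child (k : ℕ) : GTree rk → GTree rk
  | var z => z.elim
  | node a ts => if h : k < rk a then ts ⟨k, h⟩ else node a ts

theorem rootSymbol_replaceAt_cons (t s : GTree rk) (k : ℕ) (x : Pos) :
    (t.replaceAt (k :: x) s).rootSymbol = t.rootSymbol := by
  rcases t with z | ⟨a, ts⟩
  · exact z.elim
  · rfl

theorem child_replaceAt_cons {t : GTree rk} (s : GTree rk) (k : ℕ) (x : Pos) {l : ℕ}
    (hl : l < rk t.rootSymbol) :
    (t.replaceAt (k :: x) s).child l =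
      if l = k then (t.child l).replaceAt x s else t.child l := by
  rcases t with z | ⟨a, ts⟩
  · exact z.elim
  · simp only [rootSymbol] at hl
    simp [replaceAt, child, hl]

end RTree

namespace WTGc

open RTree

variable {A : Type*} {rk : A → ℕ} {Q : Type*} {I : Type*}

open Classical in
theorem formWt_node_eq_ite (G : WTGc rk Q) {a : A} (ξs : Fin (rk a) → RTree rk Q)
    (t : GTree rk) : G.formWt (node a ξs) t =
      if t.rootSymbol = a then ∏ k : Fin (rk a), G.formWt (ξs k) (t.child k) else 0 := by
  rcases t with z | ⟨b, ts⟩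
  · exact z.elim
  · by_cases hab : a = b
    · subst hab
      simp [formWt_node, rootSymbol, child]
    · simp [formWt_node_ne G hab, rootSymbol, Ne.symm hab]

open Classical in
theorem formWt_node_mem {C : (I → I → ℕ) → Prop} (hC : IsSemiringClass C)
    (G : WTGc rk Q) {s : I → GTree rk} {x : Pos}
    (ih : ∀ (ξ : RTree rk Q) (T : I → GTree rk), C fun i j => G.formWt ξ ((T j).replaceAt x (s i)))
    (k : ℕ) {a : A} (ξs : Fin (rk a) → RTree rk Q) (T : I → GTree rk) :
    C fun i j => G.formWt (node a ξs) ((T j).replaceAt (k :: x) (s i)) := by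
  have h : (fun i j => G.formWt (node a ξs) ((T j).replaceAt (k :: x) (s i))) = fun i j =>
      (if (T j).rootSymbol = a then 1 else 0) * ∏ l : Fin (rk a),
        if (l : ℕ) = k then G.formWt (ξs l) (((T j).child l).replaceAt x (s i))
        else G.formWt (ξs l) ((T j).child l) := by
    funext i j
    rw [formWt_node_eq_ite, rootSymbol_replaceAt_cons]
    split_ifs with hr
    · rw [one_mul]
      refine Finset.prod_congr rfl fun l _ => ?_
      rw [child_replaceAt_cons _ _ _ (by rw [hr]; exact l.2)]
      split_ifs <;> rfl
    · rw [zero_mul]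
  rw [h]
  refine hC.mul (hC.right _) (hC.prod _ fun l _ => ?_)
  split_ifs
  · exact ih _ _
  · exact hC.right _

-- Unfolding the weight along the path to `x` uses only sums, products and constraint indicators.
-- Subtrees off the path depend on `j` alone; at the end of the path only `s i` remains.
open Classical in
theorem formWt_replaceAt_mem {C : (I → I → ℕ) → Prop} (hC : IsSemiringClass C)
    (G : WTGc rk Q) {s : I → GTree rk}
    (hE : ∀ p ∈ G.prods, ∀ (T : I → GTree rk) (x : Pos),
      C fun i j => if ((T j).replaceAt x (s i)).Satisfies p.constr then 1 else 0)
    (x : Pos) (ξ : RTree rk Q) (T : I → GTree rk) :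
    C fun i j => G.formWt ξ ((T j).replaceAt x (s i)) := by
  induction x generalizing ξ T with
  | nil => simpa using hC.left _
  | cons k x ih =>
    rcases ξ with q | ⟨a, ξs⟩
    · change C fun i j => G.val q _
      simp only [val_eq_sum]
      refine hC.sum _ fun p hp => ?_
      have h : (fun i j => if p.target = q ∧ ((T j).replaceAt (k :: x) (s i)).Satisfies p.constr
            then G.wt p * G.formWt p.lhs ((T j).replaceAt (k :: x) (s i)) else 0) = fun i j =>
          (if p.target = q then G.wt p else 0) *
            (if ((T j).replaceAt (k :: x) (s i)).Satisfies p.constr then 1 else 0) *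
            G.formWt p.lhs ((T j).replaceAt (k :: x) (s i)) := by
        funext i j
        by_cases h1 : p.target = q <;>
          by_cases h2 : ((T j).replaceAt (k :: x) (s i)).Satisfies p.constr <;> simp [h1, h2]
      rw [h]
      refine hC.mul (hC.mul (hC.left _) (hE p hp T _)) ?_
      rcases hl : p.lhs with z | ⟨a, ξs⟩
      · exact (G.lhs_ne_state p hp z hl).elim
      · exact formWt_node_mem hC G ih k ξs T
    · exact formWt_node_mem hC G ih k ξs T

theorem IsWTG.finiteRank_sem [Fintype Q] {G : WTGc rk Q} (hG : G.IsWTG) (s T : I → GTree rk)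
    (x : Pos) : FiniteRank fun i j => G.sem ((T j).replaceAt x (s i)) := by
  classical
  have hC := finiteRank_isSemiringClass (I := I)
  simp only [sem_eq_sum_val]
  refine hC.sum _ fun q _ => hC.mul (hC.left _) ?_
  refine formWt_replaceAt_mem hC G (fun p hp T x => ?_) x (var q) T
  simpa [hG p hp, Satisfies] using hC.left fun _ => 1

end WTGc
end HomTree

/-! ### Equality constraints along a nonprincipal ultrafilter. -/

namespace HomTree

namespace WTGc

open RTree

variable {A : Type*} {rk : A → ℕ} {Q : Type*} {I : Type*}

/-- Two different generic indices `i`, `i'` share some `j`, which would give `s i = s i'`. -/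
theorem not_eventually_eq_some {U : Ultrafilter I} (hU : ∀ i, ∀ᶠ j in (U : Filter I), j ≠ i)
    {α : Type*} {s : I → α} (hs : Function.Injective s) (B : I → Option α) :
    ¬ ∀ᶠ i in U, ∀ᶠ j in U, B j = some (s i) := by
  intro h
  obtain ⟨i, hi⟩ := h.exists
  obtain ⟨i', hi', hne⟩ := (h.and (hU i)).exists
  obtain ⟨j, hj, hj'⟩ := (hi.and hi').exists
  rw [hj, Option.some.injEq] at hj'
  exact hne (hs hj').symm

/-- Any two generic `i` share some `j`, so `a` is generically constant, and `b` generically takes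
the same value. -/
theorem eventually_diag_of_eq {U : Ultrafilter I} {α : Type*} {a b : I → α}
    (h : ∀ᶠ i in U, ∀ᶠ j in U, a i = b j) : ∀ᶠ i in U, a i = b i := by
  obtain ⟨i, hi⟩ := h.exists
  filter_upwards [h, hi] with k hk hk'
  obtain ⟨j, hj, hj'⟩ := (hk.and hi).exists
  rw [hj, ← hj', hk']

/-- The subtree at `c` depends on `i` alone if `c` lies at or below `x`, and on `j` alone if `c` and
`x` are incomparable. It can mix both only if `c` lies on the path to `x`. -/
theorem subtreeAt_replaceAt_cases (s T : I → GTree rk) (x c : Pos) :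
    (x <+: c ∧ ∃ a : I → Option (GTree rk), ∀ i j, x ∈ (T j).positions →
      ((T j).replaceAt x (s i)).subtreeAt c = a i) ∨
    (∃ b : I → Option (GTree rk), ∀ i j, ((T j).replaceAt x (s i)).subtreeAt c = b j) ∨
    c <+: x := by
  by_cases h1 : x <+: c
  · obtain ⟨z, rfl⟩ := h1
    exact Or.inl ⟨⟨z, rfl⟩, fun i => (s i).subtreeAt z, fun i j hx => subtreeAt_replaceAt_append hx _ _⟩
  · by_cases h2 : c <+: x
    · exact Or.inr (Or.inr h2)
    · exact Or.inr (Or.inl ⟨fun j => (T j).subtreeAt c, fun i j =>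
        subtreeAt_replaceAt_of_not_prefix _ _ h2 h1⟩)

theorem not_eventually_prefix_eq {U : Ultrafilter I} (hU : ∀ i, ∀ᶠ j in (U : Filter I), j ≠ i)
    {s : I → GTree rk} (hs : Function.Injective s) {T : I → GTree rk} {x : Pos}
    (hx : ∀ᶠ j in U, x ∈ (T j).positions) {c : Pos} (hc : c <+: x)
    (b : I → Option (GTree rk)) :
    ¬ ∀ᶠ i in U, ∀ᶠ j in U, ((T j).replaceAt x (s i)).subtreeAt c = b j := by
  intro h
  obtain ⟨y, rfl⟩ := hc
  refine not_eventually_eq_some hU hs (fun j => (b j).bind fun r => r.subtreeAt y) ?_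
  filter_upwards [h] with i hi
  filter_upwards [hi, hx] with j hj hxj
  rw [← hj, ← subtreeAt_append, ← List.append_nil (c ++ y)]
  simpa using subtreeAt_replaceAt_append hxj (s i) []

/-- Distinct index positions of `ξ` are incomparable. If one lies on the path to `x`, the other is
therefore off it and sees only `j`, while the first one determines `s i`; injectivity of `s`
excludes a generic equality. In all other cases each side depends on a single index, and a generic
equality passes to the diagonal. -/
theorem eventually_diag_subtreeAt_eq {U : Ultrafilter I} (hU : ∀ i, ∀ᶠ j in (U : Filter I), j ≠ i)
    {s : I → GTree rk} (hs : Function.Injective s) {T : I → GTree rk} {x : Pos}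
    (hx : ∀ᶠ j in U, x ∈ (T j).positions) {ξ : RTree rk Q} {c c' : Pos}
    (hc : c ∈ ξ.indexPositions) (hc' : c' ∈ ξ.indexPositions)
    (h : ∀ᶠ i in U, ∀ᶠ j in U, ((T j).replaceAt x (s i)).subtreeAt c =
      ((T j).replaceAt x (s i)).subtreeAt c') :
    ∀ᶠ i in U, ((T i).replaceAt x (s i)).subtreeAt c =
      ((T i).replaceAt x (s i)).subtreeAt c' := by
  obtain ⟨q, hq⟩ := hc
  obtain ⟨r, hr⟩ := hc'
  by_cases hcc : c = c'
  · simp [hcc]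
  rcases subtreeAt_replaceAt_cases s T x c with ⟨hp, a, ha⟩ | ⟨b, hb⟩ | hp
  · rcases subtreeAt_replaceAt_cases s T x c' with ⟨hp', a', ha'⟩ | ⟨b', hb'⟩ | hp'
    · filter_upwards [h, hx] with i hi hxi
      obtain ⟨j, hj, hxj⟩ := (hi.and hx).exists
      rw [ha i j hxj, ha' i j hxj] at hj
      rw [ha i i hxi, ha' i i hxi, hj]
    · have : ∀ᶠ i in U, a i = b' i := by
        refine eventually_diag_of_eq ?_
        filter_upwards [h] with i hi
        filter_upwards [hi, hx] with j hj hxj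
        rwa [ha i j hxj, hb'] at hj
      filter_upwards [this, hx] with i hi hxi
      rw [ha i i hxi, hb', hi]
    · exact (hcc (hr.eq_of_prefix hq (hp'.trans hp)).symm).elim
  · rcases subtreeAt_replaceAt_cases s T x c' with ⟨hp', a', ha'⟩ | ⟨b', hb'⟩ | hp'
    · have : ∀ᶠ i in U, a' i = b i := by
        refine eventually_diag_of_eq ?_
        filter_upwards [h] with i hi
        filter_upwards [hi, hx] with j hj hxj
        rw [ha' i j hxj, hb] at hj
        exact hj.symm
      filter_upwards [this, hx] with i hi hxi
      rw [ha' i i hxi, hb, hi]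
    · obtain ⟨i, hi⟩ := h.exists
      filter_upwards [hi] with j hj
      rw [hb, hb'] at hj ⊢
      exact hj
    · refine (not_eventually_prefix_eq hU hs hx hp' b ?_).elim
      simpa only [hb, eq_comm] using h
  · rcases subtreeAt_replaceAt_cases s T x c' with ⟨hp', -⟩ | ⟨b', hb'⟩ | hp'
    · exact (hcc (hq.eq_of_prefix hr (hp.trans hp'))).elim
    · refine (not_eventually_prefix_eq hU hs hx hp b' ?_).elim
      simpa only [hb'] using h
    · rcases List.prefix_or_prefix_of_prefix hp hp' with hpp | hpp
      · exact (hcc (hq.eq_of_prefix hr hpp)).elim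
      · exact (hcc (hr.eq_of_prefix hq hpp).symm).elim

theorem eventually_diag_isSome {U : Ultrafilter I} {s T : I → GTree rk} {x : Pos}
    (hx : ∀ᶠ j in U, x ∈ (T j).positions) {c : Pos}
    (h : ∀ᶠ i in U, ∀ᶠ j in U, (((T j).replaceAt x (s i)).subtreeAt c).isSome) :
    ∀ᶠ i in U, (((T i).replaceAt x (s i)).subtreeAt c).isSome := by
  rcases subtreeAt_replaceAt_cases s T x c with ⟨-, a, ha⟩ | ⟨b, hb⟩ | ⟨y, rfl⟩
  · filter_upwards [h, hx] with i hi hxi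
    obtain ⟨j, hj, hxj⟩ := (hi.and hx).exists
    rw [ha i j hxj] at hj
    rwa [ha i i hxi]
  · obtain ⟨i, hi⟩ := h.exists
    filter_upwards [hi] with j hj
    rw [hb] at hj ⊢
    exact hj
  · obtain ⟨i, hi⟩ := h.exists
    filter_upwards [hi] with j hj
    rw [subtreeAt_replaceAt_prefix, Option.isSome_map] at hj ⊢
    exact hj

open Classical in
theorem diagGE_satisfies {U : Ultrafilter I} (hU : ∀ i, ∀ᶠ j in (U : Filter I), j ≠ i)
    {s : I → GTree rk} (hs : Function.Injective s) {ξ : RTree rk Q} {E : Finset (Pos × Pos)}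
    (hE : ∀ c ∈ E, c.1 ∈ ξ.indexPositions ∧ c.2 ∈ ξ.indexPositions) (T : I → GTree rk)
    (x : Pos) :
    DiagGE U fun i j => if ((T j).replaceAt x (s i)).Satisfies E then 1 else 0 := by
  refine diagGE_indicator fun h => ?_
  have hsat : ∀ t : GTree rk, t.Satisfies E ↔
      ∀ c ∈ E, t.subtreeAt c.1 = t.subtreeAt c.2 ∧ (t.subtreeAt c.1).isSome := by
    intro t
    refine forall₂_congr fun c _ => ⟨?_, ?_⟩
    · rintro ⟨r, h, h'⟩
      simp [h, h']
    · rintro ⟨h, h'⟩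
      obtain ⟨r, hr⟩ := Option.isSome_iff_exists.1 h'
      exact ⟨r, hr, h ▸ hr⟩
  by_cases hx : ∀ᶠ j in U, x ∈ (T j).positions
  · simp only [hsat] at h ⊢
    refine (Filter.eventually_all_finset E).2 fun c hc => ?_
    have h' : ∀ᶠ i in U, ∀ᶠ j in U, ((T j).replaceAt x (s i)).subtreeAt c.1 =
        ((T j).replaceAt x (s i)).subtreeAt c.2 ∧
          (((T j).replaceAt x (s i)).subtreeAt c.1).isSome := by
      filter_upwards [h] with i hi
      filter_upwards [hi] with j hj
      exact hj c hc
    refine Filter.Eventually.and ?_ ?_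
    · refine eventually_diag_subtreeAt_eq hU hs hx (hE c hc).1 (hE c hc).2 ?_
      filter_upwards [h'] with i hi
      exact hi.mono fun _ hj => hj.1
    · refine eventually_diag_isSome hx ?_
      filter_upwards [h'] with i hi
      exact hi.mono fun _ hj => hj.2
  -- Here `x` is almost never a position of `T j`, so the replacement does nothing and the condition
  -- involves only `j`.
  · rw [← Ultrafilter.eventually_not] at hx
    obtain ⟨i, hi⟩ := h.exists
    filter_upwards [hi, hx] with j hj hxj
    rw [replaceAt_of_notMem hxj] at hj ⊢
    exact hj

/-! ### Diagonal families, carried from the duplicating production up to a final state. -/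

/-- There are contexts for the trees `s i` whose weight to `q` exceeds, on the diagonal, a
matrix of finite rank with which it agrees off the diagonal. -/
def HasDiagFamily (G : WTGc rk Q) (U : Ultrafilter I) (s : I → GTree rk) (q : Q) : Prop :=
  ∃ (T : I → GTree rk) (x : Pos), (∀ j, (T j).subtreeAt x = some (s j)) ∧
    (∀ j, 0 < G.val q (T j)) ∧ DiagGT U fun i j => G.val q ((T j).replaceAt x (s i))

theorem replaceAt_plug_classFill {ξ : RTree rk Q} {y : Pos} {q : Q} (hy : ξ.HasIndexAt y q)
    (E : Finset (Pos × Pos)) (f : Pos → GTree rk) (t s : GTree rk) (x : Pos) :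
    (ξ.plug (classFill E f y t t)).replaceAt (y ++ x) s =
      ξ.plug (classFill E f y t (t.replaceAt x s)) := by
  rw [replaceAt_plug hy, classFill_self]
  simp [classFill]

variable {G : WTGc rk (WithBot Q)}

-- The new context fills the whole class of `y` with `T j`, and `s i` is then inserted at `y` only.
-- The production `p` contributes its indicator times the weight at `y` times a positive factor
-- depending on `j` alone. All other productions with the same target contribute a `DiagGE` matrix,
-- which cannot undo the strict excess.
open Classical in
theorem IsWTGh.hasDiagFamily_target (hG : G.IsWTGh) (hwt : ∀ p ∈ G.prods, G.wt p ≠ 0)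
    {U : Ultrafilter I} (hU : ∀ i, ∀ᶠ j in (U : Filter I), j ≠ i) {s : I → GTree rk}
    (hs : Function.Injective s) {p : Production rk (WithBot Q)} (hp : p ∈ G.prods)
    {f : Pos → GTree rk} (hsat : (p.lhs.plug f).Satisfies p.constr)
    (hf : ∀ z r, p.lhs.HasIndexAt z r → 0 < G.val r (f z)) {y : Pos} {q : WithBot Q}
    (hy : p.lhs.HasIndexAt y q) (hq : q ≠ ⊥) {T : I → GTree rk} {x : Pos}
    (hx : ∀ j, (T j).subtreeAt x = some (s j)) (hT : ∀ j, 0 < G.val q (T j))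
    (hgt : DiagGT U fun i j =>
      (if (p.lhs.plug (classFill p.constr f y (T j) ((T j).replaceAt x (s i)))).Satisfies p.constr
        then 1 else 0) * G.val q ((T j).replaceAt x (s i))) :
    HasDiagFamily G U s p.target := by
  have hg := hG.isGuard hp hy hq
  have hC := diagGE_isSemiringClass U
  have hcond := fun p (hp : p ∈ G.prods) => diagGE_satisfies hU hs (hG.constr_pos p hp)
  refine ⟨fun j => p.lhs.plug (classFill p.constr f y (T j) (T j)), y ++ x, ?_, ?_, ?_⟩
  · intro j
    rw [subtreeAt_append, subtreeAt_plug hy, classFill_self]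
    exact hx j
  · exact fun j => val_classFill_pos hG hwt hp hsat hf hy hg (hT j)
  choose c hc hc' using fun j => formWt_plug_update G hy
    (fun z => if (y, z) ∈ p.constr then T j else f z)
  have hcpos : ∀ j, 0 < c j := by
    refine fun j => hc' j fun z r hz hne => ?_
    have := classFill_pos hG hg hf (T j) (T j) hz hne
    rwa [classFill, Function.update_of_ne hne] at this
  have hval : (fun i j => G.val p.target
      ((p.lhs.plug (classFill p.constr f y (T j) (T j))).replaceAt (y ++ x) (s i))) = fun i j =>
      (if (p.lhs.plug (classFill p.constr f y (T j) ((T j).replaceAt x (s i)))).Satisfies p.constr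
        then 1 else 0) * G.val q ((T j).replaceAt x (s i)) * (G.wt p * c j) +
      ∑ p' ∈ G.prods.erase p, (if p'.target = p.target then G.wt p' else 0) *
        (if ((p.lhs.plug (classFill p.constr f y (T j) (T j))).replaceAt (y ++ x) (s i)).Satisfies
          p'.constr then 1 else 0) * G.formWt p'.lhs
            ((p.lhs.plug (classFill p.constr f y (T j) (T j))).replaceAt (y ++ x) (s i)) := by
    funext i j
    rw [val_eq_sum, ← Finset.add_sum_erase _ _ hp]
    congr 1
    · have h1 := hc j ((T j).replaceAt x (s i))
      rw [← classFill] at h1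
      rw [replaceAt_plug_classFill hy, h1]
      simp only [true_and]
      split_ifs
      · ring
      · simp
    · refine Finset.sum_congr rfl fun p' _ => ?_
      by_cases h1 : p'.target = p.target <;> by_cases h2 :
        ((p.lhs.plug (classFill p.constr f y (T j) (T j))).replaceAt (y ++ x) (s i)).Satisfies
          p'.constr <;> simp [h1, h2]
  rw [hval]
  refine (hgt.mul_diagGE (hC.right _) fun i =>
    Nat.mul_pos (Nat.pos_of_ne_zero (hwt p hp)) (hcpos i)).add_diagGE (hC.sum _ fun p' hp' => ?_)
  have hp' := Finset.mem_of_mem_erase hp'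
  exact hC.mul (hC.mul (hC.left _) (hcond p' hp' _ _))
    (formWt_replaceAt_mem hC G hcond _ _ _)

/-- With the context trivial at `u`, the constraint `(u, v)` compares `s i` with the untouched copy
`s j`. The contribution of `p` is thus zero off the diagonal and positive on it. -/
theorem IsWTGh.hasDiagFamily_of_duplication (hG : G.IsWTGh) (hwt : ∀ p ∈ G.prods, G.wt p ≠ 0)
    {U : Ultrafilter I} (hU : ∀ i, ∀ᶠ j in (U : Filter I), j ≠ i) {s : I → GTree rk}
    (hs : Function.Injective s) {p : Production rk (WithBot Q)} (hp : p ∈ G.prods)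
    {f : Pos → GTree rk} (hsat : (p.lhs.plug f).Satisfies p.constr)
    (hf : ∀ z r, p.lhs.HasIndexAt z r → 0 < G.val r (f z)) {u v : Pos} {q : WithBot Q}
    (huv : (u, v) ∈ p.constr) (hv : p.lhs.HasIndexAt v ⊥) (hu : p.lhs.HasIndexAt u q)
    (hq : q ≠ ⊥) (hsq : ∀ i, 0 < G.val q (s i)) : HasDiagFamily G U s p.target := by
  classical
  have hvu : v ≠ u := by
    rintro rfl
    exact hq (hu.unique hv)
  refine hG.hasDiagFamily_target hwt hU hs hp hsat hf hu hq (T := s) (x := []) (by simp) hsq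
    ⟨fun _ _ => 0, finiteRank_isSemiringClass.left fun _ => 0, ?_, ?_⟩
  · filter_upwards with i
    filter_upwards [hU i] with j hj
    rw [if_neg, zero_mul]
    rw [satisfies_plug_iff (hG.constr_pos p hp)]
    intro h
    have := h _ huv
    simp only [classFill_self, replaceAt_nil] at this
    simp only [classFill, Function.update_of_ne hvu, huv, if_true] at this
    exact hj (hs this).symm
  · filter_upwards with i
    rw [replaceAt_nil, if_pos (classFill_satisfies hG hp hsat u (s i)), one_mul]
    exact hsq i

/-- On the diagonal the insertion restores `T j`, so all copies in the class agree and the indicator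
of the constraints of `p` is `1`. Being `DiagGE`, it preserves the strict excess. -/
theorem IsWTGh.hasDiagFamily_step (hG : G.IsWTGh) (hwt : ∀ p ∈ G.prods, G.wt p ≠ 0)
    {U : Ultrafilter I} (hU : ∀ i, ∀ᶠ j in (U : Filter I), j ≠ i) {s : I → GTree rk}
    (hs : Function.Injective s) {p : Production rk (WithBot Q)} (hp : p ∈ G.prods)
    {f : Pos → GTree rk} (hsat : (p.lhs.plug f).Satisfies p.constr)
    (hf : ∀ z r, p.lhs.HasIndexAt z r → 0 < G.val r (f z)) {y : Pos} {q : WithBot Q}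
    (hy : p.lhs.HasIndexAt y q) (hq : q ≠ ⊥) (h : HasDiagFamily G U s q) :
    HasDiagFamily G U s p.target := by
  classical
  obtain ⟨T, x, hx, hT, hgt⟩ := h
  refine hG.hasDiagFamily_target hwt hU hs hp hsat hf hy hq hx hT ?_
  simp only [mul_comm _ (G.val q _)]
  refine hgt.mul_diagGE ?_ fun i => ?_
  · have := diagGE_satisfies hU hs (hG.constr_pos p hp)
      (fun j => p.lhs.plug (classFill p.constr f y (T j) (T j))) (y ++ x)
    simpa only [replaceAt_plug_classFill hy] using this
  · rw [replaceAt_self (hx i), if_pos (classFill_satisfies hG hp hsat y (T i))]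
    exact one_pos

theorem exists_index_of_mem_formDerivations {R : Type*} {G : WTGc rk R} {ξ : RTree rk R}
    {f : Pos → GTree rk} {d : List (Production rk R × Pos)}
    (hd : d ∈ G.formDerivations ξ (ξ.plug f)) {p : Production rk R}
    (hp : p ∈ d.map Prod.fst) :
    ∃ y r, ξ.HasIndexAt y r ∧ ∃ e ∈ G.formDerivations (var r) (f y), p ∈ e.map Prod.fst := by
  induction ξ generalizing f d with
  | var r => exact ⟨[], r, hasIndexAt_var.2 ⟨rfl, rfl⟩, d, hd, hp⟩
  | node a ξs ih =>
    rw [plug, mem_formDerivations_node] at hd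
    obtain ⟨x, hx, rfl⟩ := List.mem_map.1 hp
    rw [← hd.2, mem_joinRuns] at hx
    obtain ⟨i, w, -, hi⟩ := hx
    obtain ⟨y, r, hy, e, he, hpe⟩ := ih i (hd.1 i) (List.mem_map.2 ⟨_, hi, rfl⟩)
    exact ⟨_, r, hasIndexAt_node.2 ⟨i, y, rfl, hy⟩, e, he, hpe⟩

/-- Induction up the derivation from the use of `p`. Since `⊥` is a sink and `r ≠ ⊥`, every state
above that use is proper, as each step requires. -/
theorem IsWTGh.hasDiagFamily_of_mem (hG : G.IsWTGh) (hwt : ∀ p ∈ G.prods, G.wt p ≠ 0)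
    {U : Ultrafilter I} (hU : ∀ i, ∀ᶠ j in (U : Filter I), j ≠ i) {s : I → GTree rk}
    (hs : Function.Injective s) {p : Production rk (WithBot Q)}
    {u v : Pos} {r : WithBot Q} (huv : (u, v) ∈ p.constr) (hv : p.lhs.HasIndexAt v ⊥)
    (hu : p.lhs.HasIndexAt u r) (hr : r ≠ ⊥) (hsr : ∀ i, 0 < G.val r (s i)) (n : ℕ) :
    ∀ (t : GTree rk) (q : WithBot Q), t.height = n → ∀ d ∈ G.formDerivations (var q) t,
      p ∈ d.map Prod.fst → q ≠ ⊥ ∧ HasDiagFamily G U s q := by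
  induction n using Nat.strong_induction_on with
  | _ n ih =>
  rintro t q rfl d hd hpd
  obtain ⟨p', hp', rfl, hsat, e, he, rfl⟩ := mem_formDerivations_var.1 hd
  obtain ⟨f, rfl, hf⟩ := exists_plug_of_formWt_pos (formWt_pos_of_mem hwt he)
  by_cases hpp : p = p'
  · subst hpp
    exact ⟨fun h => hr (hG.sink_only p hp' h u r hu),
      hG.hasDiagFamily_of_duplication hwt hU hs hp' hsat hf huv hv hu hr hsr⟩
  · have hpe : p ∈ e.map Prod.fst := by
      rw [List.map_append, List.mem_append] at hpd
      exact hpd.resolve_right (by simpa using hpp)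
    obtain ⟨y, r', hy, e', he', hpe'⟩ := exists_index_of_mem_formDerivations he hpe
    have h1 := height_add_length_le (subtreeAt_plug hy f)
    have h2 := List.length_pos_of_ne_nil (hasIndexAt_lhs_ne_nil hp' hy)
    obtain ⟨h3, h4⟩ := ih _ (by omega) (f y) r' rfl e' he' hpe'
    exact ⟨fun h => h3 (hG.sink_only p' hp' h y r' hy),
      hG.hasDiagFamily_step hwt hU hs hp' hsat hf hy h3 h4⟩

/-- The excess at the final state `q` survives adding the other states, so the matrix of `G.sem` is
`DiagGT`, whereas an automaton makes it of finite rank. -/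
theorem HasDiagFamily.not_isRegular_sem {R : Type*} [Fintype R] {G : WTGc rk R}
    {U : Ultrafilter I} {s : I → GTree rk} {q : R} (h : HasDiagFamily G U s q)
    (hq : G.final q ≠ 0)
    (hE : ∀ p ∈ G.prods, ∀ c ∈ p.constr,
      c.1 ∈ p.lhs.indexPositions ∧ c.2 ∈ p.lhs.indexPositions)
    (hU : ∀ i, ∀ᶠ j in (U : Filter I), j ≠ i) (hs : Function.Injective s) :
    ¬ IsRegular G.sem := by
  classical
  rintro ⟨S, _, H, ⟨hH, -⟩, hsem⟩
  obtain ⟨T, x, -, -, hgt⟩ := h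
  have hC := diagGE_isSemiringClass U
  have hfr := hH.finiteRank_sem s T x
  simp only [hsem, sem_eq_sum_val] at hfr
  refine hfr.not_diagGT (U := U) ?_
  simp only [← Finset.add_sum_erase _ _ (Finset.mem_univ q), mul_comm (G.final _)]
  refine (hgt.mul_diagGE (hC.left _) fun _ => Nat.pos_of_ne_zero hq).add_diagGE
    (hC.sum _ fun q' _ => hC.mul ?_ (hC.left _))
  exact formWt_replaceAt_mem hC G (fun p hp => diagGE_satisfies hU hs (hE p hp)) x (var q') T

end WTGc
end HomTree

theorem mainTheorem2 {A : Type*} [Finite A] (rk : A → ℕ) {Q : Type*} [Fintype Q]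
    (G : HomTree.WTGc rk (WithBot Q)) (hG : G.IsWTGh) (htrim : G.IsTrim)
    (hdup : G.LargeDuplication) :
    ¬ HomTree.IsRegular G.sem := by
  obtain ⟨p, hp, u, v, huv, hv, r, hr, hu, t, ht, d, hd⟩ := hdup
  have hwt := fun p (hp : p ∈ G.prods) => htrim.wt_ne_zero hG hp
  obtain ⟨r, rfl⟩ := WithBot.ne_bot_iff_exists.1 hr
  have hinf : {t | 0 < G.val r t}.Infinite := fun hfin =>
    ht.not_ge (HomTree.WTGc.height_le_of_finite hG hwt
      (HomTree.RTree.infinite_of_height_pos (Nat.zero_lt_of_lt ht)) hfin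
      (HomTree.WTGc.formWt_pos_of_mem hwt hd))
  have := hinf.to_subtype
  -- The index set consists of the trees accepted by `r` themselves. It is infinite, so its
  -- hyperfilter is a nonprincipal ultrafilter.
  have hU := fun i : {t | 0 < G.val r t} =>
    Filter.compl_mem_hyperfilter_of_finite (Set.finite_singleton i)
  -- Since `p` has a constraint, it is none of the productions exempt from trimness.
  obtain ⟨t₀, q, d₀, hd₀, hne, hmem⟩ := htrim p hp fun a h => by
    rw [h] at huv
    simp [HomTree.sinkProduction] at huv
  exact (hG.hasDiagFamily_of_mem hwt hU Subtype.val_injective huv hv hu hr (fun i => i.2) _ t₀ q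
    rfl d₀ hd₀ hmem).2.not_isRegular_sem (left_ne_zero_of_mul hne) hG.constr_pos hU
    Subtype.val_injective
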